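/- For a cardinal $\lambda$ put $\beth_0(\lambda)=\lambda$, $\beth_{\alpha+1}(\lambda)=2^{\beth_\alpha(\lambda)}$ and $\beth_\delta(\lambda)=\sup_{\alpha<\delta}\beth_\alpha(\lambda)$ for limit $\delta$. Conventions. Let $\mathbf K=(K,\le_{\mathbf K})$ be an abstract elementary class (AEC) in a finitary language $L$; $\mathrm{LS}(\mathbf K)$ is the least cardinal $\mu\ge|L|+\aleph_0$ such that for all $N\in K$ and $A\subseteq|N|$ there is $M\le_{\mathbf K}N$ with $A\subseteq|M|$ and $\|M\|\le|A|+\mu$. Galois types are orbital types over sets: $\mathrm{gtp}(a/A,M)=\mathrm{gtp}(b/A,N)$ (where $A\subseteq|M|\cap|N|$ and $a\in{}^n|M|$, $b\in{}^n|N|$) is the equivalence relation generated by the pairs for which there are $\mathbf K$-embeddings $f:M\to N'$, $g:N\to N'$ with $f\restriction A=g\restriction A$ and $f(a)=g(b)$. For $A\subseteq|M|$, $M\in K$, let $gS^{<2}(A;M)$ be the set of all $\mathrm{gtp}(a/A,M)$ with $a$ a tuple from $M$ of length $<2$. * $\mathbf K$ is stable in $\mu$ if $|gS^{<2}(A;M)|\le\mu$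 for all $M\in K$ and all $A\subseteq|M|$ with $|A|\le\mu$; otherwise it is unstable in $\mu$. $\mathbf K$ is stable if it is stable in some $\mu\ge\mathrm{LS}(\mathbf K)$. * $\mathbf K$ has the order property* of length $\mu$ if there are $n<\omega$, a linear order $I$ with $|I|=\mu$, a model $M\in K$ and $n$-tuples $a_i$ $(i\in I)$ from $M$ such that $\mathrm{gtp}(a_{i_0}a_{i_1}/\emptyset,M)\ne\mathrm{gtp}(a_{j_1}a_{j_0}/\emptyset,M)$ whenever $i_0<i_1$ and $j_0<j_1$ in $I$. * $\mathbf K$ is $(<\aleph_0)$-tame if any two distinct Galois types $p\neq q$ of tuples of length $<2$ over a subset $A$ of a model (realized in possibly different models containing $A$) satisfy $p\restriction A_0\ne q\restriction A_0$ for some finite $A_0\subseteq A$. Proposition. Let $\lambda$ be an infinite cardinal and $\alpha$ an ordinal with $\lambda\le\alpha<(2^\lambda)^+$. Then there is an AEC $\mathbf K$ with $\mathrm{LS}(\mathbf K)=\lambda$ such that: 1. $\mathbf K$ is stable; indeed it is stable in every cardinal $\mu\ge\beth_\alpha(\lambda)$; 2. $\mathbf K$ has the order property* of length $\mu$ for every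 cardinal $\mu\le\beth_\alpha(\lambda)$; 3. $\mathbf K$ is unstable in every cardinal $\mu<\beth_\alpha(\lambda)$, in particular in every cardinal in $[\lambda,\beth_\alpha(\lambda))$; 4. $\mathbf K$ has the joint embedding property, has no maximal models (every model has a proper $\le_{\mathbf K}$-extension), and is $(<\aleph_0)$-tame, but $\mathbf K$ fails the amalgamation property. -/

import Mathlib

open FirstOrder Cardinal

universe u

/-- The cardinals `ℶ_α(κ)`: `ℶ_0(κ) = κ`, `ℶ_{α+1}(κ) = 2 ^ ℶ_α(κ)`, and suprema at limits. -/
noncomputable def bethFrom (κ : Cardinal.{u}) (α : Ordinal.{u}) : Cardinal.{u} :=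
  Ordinal.limitRecOn α κ (fun _ c => 2 ^ c) (fun δ _ c => ⨆ β : Set.Iio δ, c β.1 β.2)

/-- An abstract elementary class in the finitary language `L`, with models in `Type u`.
`Mem M` says that the `L`-structure `M` belongs to the class, and `Strong S`, for a substructure
`S` of `N`, says that `S ≤_K N`. -/
structure AEC (L : FirstOrder.Language.{u, u}) where
  Mem : (M : Type u) → [L.Structure M] → Prop
  Strong : {N : Type u} → [L.Structure N] → L.Substructure N → Prop
  nonempty_of_mem : ∀ {M : Type u} [L.Structure M], Mem M → Nonempty M
  /-- The class is closed under isomorphisms. -/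
  mem_of_equiv : ∀ {M N : Type u} [L.Structure M] [L.Structure N],
    (M ≃[L] N) → Mem M → Mem N
  /-- The ordering is closed under isomorphisms. -/
  strong_of_equiv : ∀ {M N : Type u} [L.Structure M] [L.Structure N] (e : M ≃[L] N)
    (S : L.Substructure M), Strong S → Strong (S.map e.toHom)
  /-- The ordering relates members of the class only. -/
  mem_left : ∀ {N : Type u} [L.Structure N] (S : L.Substructure N), Strong S → Mem S
  mem_right : ∀ {N : Type u} [L.Structure N] (S : L.Substructure N), Strong S → Mem N
  /-- Reflexivity: `N ≤_K N`. -/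
  strong_refl : ∀ {N : Type u} [L.Structure N], Mem N → Strong (⊤ : L.Substructure N)
  /-- Transitivity: `S ≤_K T` and `T ≤_K N` imply `S ≤_K N`. -/
  strong_trans : ∀ {N : Type u} [L.Structure N] (T : L.Substructure N) (S : L.Substructure T),
    Strong S → Strong T → Strong (S.map T.subtype.toHom)
  /-- Coherence: if `S ⊆ T`, `S ≤_K N` and `T ≤_K N`, then `S ≤_K T`. -/
  coherence : ∀ {N : Type u} [L.Structure N] (S T : L.Substructure N), S ≤ T →
    Strong S → Strong T → Strong (S.comap T.subtype.toHom)
  /-- Tarski-Vaught chain axiom: the union of a `≤_K`-increasing chain of limit length belongs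
  to the class and is a `≤_K`-extension of every member of the chain. (The members of the chain
  are substructures of some `L`-structure `U`, which need not be in the class.) -/
  strong_iSup : ∀ {ι : Type u} [LinearOrder ι] [WellFoundedLT ι] [Nonempty ι] [NoMaxOrder ι]
    {U : Type u} [L.Structure U] (S : ι → L.Substructure U), Monotone S →
    (∀ i j, i ≤ j → Strong ((S i).comap (S j).subtype.toHom)) →
    Mem (⨆ i, S i : L.Substructure U) ∧
      ∀ i, Strong ((S i).comap (⨆ j, S j : L.Substructure U).subtype.toHom)
  /-- Smoothness: if every member of a `≤_K`-increasing chain is `≤_K N`, so is the union. -/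
  iSup_strong : ∀ {ι : Type u} [LinearOrder ι] [WellFoundedLT ι] [Nonempty ι] [NoMaxOrder ι]
    {N : Type u} [L.Structure N] (S : ι → L.Substructure N), Monotone S →
    (∀ i j, i ≤ j → Strong ((S i).comap (S j).subtype.toHom)) →
    (∀ i, Strong (S i)) → Strong (⨆ i, S i)
  /-- Löwenheim-Skolem-Tarski axiom. -/
  exists_lowenheimSkolem : ∃ μ : Cardinal.{u}, ℵ₀ ≤ μ ∧ L.card ≤ μ ∧
    ∀ {N : Type u} [L.Structure N], Mem N → ∀ A : Set N,
      ∃ S : L.Substructure N, Strong S ∧ A ⊆ S ∧ #S ≤ #A + μ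

namespace AEC

variable {L : FirstOrder.Language.{u, u}} (K : AEC L)

/-- The Löwenheim-Skolem number `LS(K)`: the least `μ ≥ |L| + ℵ₀` such that each subset `A` of
each model `N` is contained in some `S ≤_K N` with at most `|A| + μ` elements. -/
noncomputable def LS : Cardinal.{u} :=
  sInf {μ : Cardinal.{u} | ℵ₀ ≤ μ ∧ L.card ≤ μ ∧
    ∀ {N : Type u} [L.Structure N], K.Mem N → ∀ A : Set N,
      ∃ S : L.Substructure N, K.Strong S ∧ A ⊆ S ∧ #S ≤ #A + μ}

/-- `f` is a `K`-embedding: an isomorphism of `M` onto some `f[M] ≤_K N`. -/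
def IsEmb {M N : Type u} [L.Structure M] [L.Structure N] (f : M ↪[L] N) : Prop :=
  K.Mem M ∧ K.Mem N ∧ K.Strong f.toHom.range

/-- The amalgamation property. -/
def AP : Prop :=
  ∀ {M₀ M₁ M₂ : Type u} [L.Structure M₀] [L.Structure M₁] [L.Structure M₂]
    (f₁ : M₀ ↪[L] M₁) (f₂ : M₀ ↪[L] M₂), K.IsEmb f₁ → K.IsEmb f₂ →
    ∃ (N : Type u) (_ : L.Structure N) (g₁ : M₁ ↪[L] N) (g₂ : M₂ ↪[L] N),
      K.IsEmb g₁ ∧ K.IsEmb g₂ ∧ ∀ x, g₁ (f₁ x) = g₂ (f₂ x)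

/-- The joint embedding property. -/
def JEP : Prop :=
  ∀ {M₁ M₂ : Type u} [L.Structure M₁] [L.Structure M₂], K.Mem M₁ → K.Mem M₂ →
    ∃ (N : Type u) (_ : L.Structure N) (g₁ : M₁ ↪[L] N) (g₂ : M₂ ↪[L] N),
      K.IsEmb g₁ ∧ K.IsEmb g₂

/-- No maximal models: each model has a proper `K`-extension. -/
def NMM : Prop :=
  ∀ {M : Type u} [L.Structure M], K.Mem M →
    ∃ (N : Type u) (_ : L.Structure N) (f : M ↪[L] N), K.IsEmb f ∧ ¬ Function.Surjective f

/-- A triple `(a, A, M)`: a model `M` of `K`, an (injected) subset `A` and an `n`-tuple `a`. -/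
structure Triple (A : Type u) (n : ℕ) : Type (u + 1) where
  carrier : Type u
  [str : L.Structure carrier]
  mem : K.Mem carrier
  base : A ↪ carrier
  pt : Fin n → carrier

attribute [instance] Triple.str

variable {K}

/-- `(a, A, M)` and `(b, A, N)` are atomically equivalent if `M` and `N` have `K`-embeddings
into a common model which agree on `A` and send `a` and `b` to the same tuple. -/
def Triple.AtomicEq {A : Type u} {n : ℕ} (x y : K.Triple A n) : Prop :=
  ∃ (N : Type u) (_ : L.Structure N) (f : x.carrier ↪[L] N) (g : y.carrier ↪[L] N),
    K.IsEmb f ∧ K.IsEmb g ∧ (∀ a, f (x.base a) = g (y.base a)) ∧ ∀ i, f (x.pt i) = g (y.pt i)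

/-- Replace `A` by a subset in a triple. -/
def Triple.restrict {A : Type u} {n : ℕ} (x : K.Triple A n) (A₀ : Set A) : K.Triple A₀ n where
  carrier := x.carrier
  mem := x.mem
  base := (Function.Embedding.subtype _).trans x.base
  pt := x.pt

variable (K)

/-- Galois types of `n`-tuples over `A`: classes of triples for the equivalence relation that is
generated by atomic equivalence. -/
def GType (A : Type u) (n : ℕ) : Type (u + 1) :=
  Quot (Triple.AtomicEq (K := K) (A := A) (n := n))

variable {K}

/-- The restriction `p ↾ A₀` of a Galois type. -/
def GType.restrict {A : Type u} {n : ℕ} (p : K.GType A n) (A₀ : Set A) : K.GType A₀ n :=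
  Quot.map (fun x => x.restrict A₀)
    (fun _ _ ⟨N, i, f, g, hf, hg, hA, hp⟩ => ⟨N, i, f, g, hf, hg, fun a => hA a, hp⟩) p

variable (K)

/-- The Galois type `gtp(a/A, M)`. -/
def gtp {M : Type u} [L.Structure M] (hM : K.Mem M) (A : Set M) {n : ℕ} (a : Fin n → M) :
    K.GType A n :=
  Quot.mk _ ⟨M, hM, Function.Embedding.subtype _, a⟩

/-- `gS^{<n}(A; M)`: the Galois types over `A` of the tuples of length `< n` from `M`. -/
def gS (n : ℕ) {M : Type u} [L.Structure M] (hM : K.Mem M) (A : Set M) :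
    Set (Σ k : ℕ, K.GType A k) :=
  {p | ∃ k, k < n ∧ ∃ a : Fin k → M, p = ⟨k, K.gtp hM A a⟩}

/-- `K` is stable in `μ`: `|gS^{<2}(A; M)| ≤ μ` for all models `M` and `A ⊆ M` with `|A| ≤ μ`. -/
def StableIn (μ : Cardinal.{u}) : Prop :=
  ∀ {M : Type u} [L.Structure M] (hM : K.Mem M) (A : Set M), #A ≤ μ →
    #(K.gS 2 hM A) ≤ Cardinal.lift.{u + 1} μ

/-- `K` is stable if it is stable in some `μ ≥ LS(K)`. -/
def Stable : Prop :=
  ∃ μ : Cardinal.{u}, K.LS ≤ μ ∧ K.StableIn μ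

/-- `K` is `(<κ)`-tame (for types of length `< 2`): distinct types over `A` differ over a subset
of `A` with fewer than `κ` elements. -/
def Tame (κ : Cardinal.{u}) : Prop :=
  ∀ {A : Type u} {k : ℕ}, k < 2 → ∀ p q : K.GType A k, p ≠ q →
    ∃ A₀ : Set A, #A₀ < κ ∧ p.restrict A₀ ≠ q.restrict A₀

/-- The order property* of length `μ`: for some finite `n` there are a linear order `I` with `μ`
elements and `n`-tuples `a i`, `i ∈ I`, in some model `M`, such that
`gtp(a i₀ ⌢ a i₁ / ∅, M) ≠ gtp(a j₁ ⌢ a j₀ / ∅, M)` whenever `i₀ < i₁` and `j₀ < j₁`. -/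
def OrderPropertyStar (μ : Cardinal.{u}) : Prop :=
  ∃ (n : ℕ) (I : Type u) (_ : LinearOrder I) (M : Type u) (_ : L.Structure M) (hM : K.Mem M)
    (a : I → Fin n → M), #I = μ ∧
    ∀ i₀ i₁ j₀ j₁ : I, i₀ < i₁ → j₀ < j₁ →
      K.gtp hM ∅ (Fin.append (a i₀) (a i₁)) ≠ K.gtp hM ∅ (Fin.append (a j₁) (a j₀))

end AEC

/-! The class consists of labelled hierarchies, ordered by substructure. Let `Γ` have size `λ`. The
label of an element is a subset of `Γ`, and labels carry a rank below `α` such that every rank is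
attained by `2^λ` labels; this is possible because `|α| ≤ 2^λ`. In each component, two distinct
elements with the same label are separated by a member of lower rank. By induction a component has
at most `ℶ_β(λ)` elements of rank below `β` (`IsHier.card_rank_lt_le`), and a cumulative hierarchy
attains these bounds (`exists_standard`).

The function `wit` names the separating member, so the axioms are universal. A disjoint union of
models is again a model, whence joint embedding and no maximal models. In a universal class with
joint embedding, Galois types are exactly atomic types (`sameAtoms_of_mk_eq`, `mk_eq_of_sameAtoms`),
which gives tameness and reduces every statement about types to atomic formulas.

Stability from `ℶ_α(λ)` on: the components that meet `A` have at most `|A|·ℶ_α(λ)` elements, and an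
element outside them has a type over `A` determined by its type over the empty set, with at most
`2^λ` possibilities. Below `ℶ_α(λ)`, the elements of rank at most `β` in the standard component have
distinct types over those of rank below `β`. The relation `lt`, subject to no axiom except that
related elements share a component, may linearly order that component and gives the order property.
Amalgamation fails because an element of rank `0` is determined by its label and component, so two
extensions can disagree on a membership. -/

namespace FirstOrder.Language

/-! ### Atomic types and the substructures they generate -/

open Structure

variable {L : Language.{u, u}} {M N P : Type u} [L.Structure M] [L.Structure N] [L.Structure P]
  {β : Type u}

/-- Two families of elements satisfy the same atomic formulas. -/
structure SameAtoms (L : Language.{u, u}) {M N : Type u} [L.Structure M] [L.Structure N]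
    {β : Type u} (v : β → M) (w : β → N) : Prop where
  eq_iff : ∀ s t : L.Term β, s.realize v = t.realize v ↔ s.realize w = t.realize w
  rel_iff : ∀ {n : ℕ} (R : L.Relations n) (ts : Fin n → L.Term β),
    RelMap R (fun i => (ts i).realize v) ↔ RelMap R (fun i => (ts i).realize w)

theorem SameAtoms.refl (v : β → M) : L.SameAtoms v v := ⟨fun _ _ => Iff.rfl, fun _ _ => Iff.rfl⟩

theorem SameAtoms.symm {v : β → M} {w : β → N} (h : L.SameAtoms v w) : L.SameAtoms w v :=
  ⟨fun s t => (h.eq_iff s t).symm, fun R ts => (h.rel_iff R ts).symm⟩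

theorem SameAtoms.trans {v : β → M} {w : β → N} {z : β → P} (h : L.SameAtoms v w)
    (h' : L.SameAtoms w z) : L.SameAtoms v z :=
  ⟨fun s t => (h.eq_iff s t).trans (h'.eq_iff s t),
    fun R ts => (h.rel_iff R ts).trans (h'.rel_iff R ts)⟩

theorem SameAtoms.comp_embedding (f : M ↪[L] N) (v : β → M) : L.SameAtoms v (f ∘ v) := by
  have h : ∀ t : L.Term β, t.realize (f ∘ v) = f (t.realize v) := fun t =>
    HomClass.realize_term f
  refine ⟨fun s t => ?_, fun R ts => ?_⟩
  · rw [h, h, f.injective.eq_iff]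
  · simp_rw [h]
    exact (f.map_rel R (fun i => (ts i).realize v)).symm

theorem mem_closure_range_iff {v : β → M} {x : M} :
    x ∈ Substructure.closure L (Set.range v) ↔ ∃ t : L.Term β, t.realize v = x := by
  constructor
  · intro hx
    obtain ⟨t, rfl⟩ := Substructure.mem_closure_iff_exists_term.1 hx
    refine ⟨t.relabel (Set.rangeSplitting v), ?_⟩
    rw [Term.realize_relabel]
    congr 1
    funext y
    exact Set.apply_rangeSplitting v y
  · rintro ⟨t, rfl⟩
    exact t.realize_mem _ fun a => Substructure.subset_closure ⟨a, rfl⟩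

/-- If `v` and `w` satisfy the same atomic formulas, the substructure generated by `v` embeds
over `v ↦ w`. -/
theorem SameAtoms.exists_embedding {v : β → M} {w : β → N} (h : L.SameAtoms v w) :
    ∃ g : Substructure.closure L (Set.range v) ↪[L] N,
      ∀ b, g ⟨v b, Substructure.subset_closure ⟨b, rfl⟩⟩ = w b := by
  choose tm htm using fun x : Substructure.closure L (Set.range v) =>
    mem_closure_range_iff.1 x.2
  -- The image of `x` does not depend on the term chosen to represent it, since the same equations
  -- between terms hold at `v` and at `w`.
  have key : ∀ (t : L.Term β) (x : Substructure.closure L (Set.range v)), t.realize v = x →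
      (tm x).realize w = t.realize w := fun t x hx =>
    (h.eq_iff _ _).1 ((htm x).trans hx.symm)
  refine ⟨{ toFun := fun x => (tm x).realize w, inj' := ?_, map_fun' := ?_, map_rel' := ?_ }, ?_⟩
  · intro x y hxy
    have := (h.eq_iff _ _).2 hxy
    rw [htm, htm] at this
    exact Subtype.ext this
  · intro n f xs
    refine key (Term.func f fun i => tm (xs i)) _ ?_
    simp only [Term.realize_func, htm]
    rfl
  · intro n R xs
    refine (h.rel_iff R fun i => tm (xs i)).symm.trans ?_
    simp only [htm]
    rfl
  · intro b
    exact key (Term.var b) _ rfl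

end FirstOrder.Language

/-! ### Universal classes as abstract elementary classes -/

namespace AEC

open FirstOrder.Language Structure

variable {L : FirstOrder.Language.{u, u}}

section SameAtoms

variable {K : AEC L}

/-- The enumeration of the base and of the tuple of a triple. -/
def Triple.val {A : Type u} {n : ℕ} (x : K.Triple A n) : A ⊕ ULift.{u} (Fin n) → x.carrier :=
  Sum.elim x.base (x.pt ∘ ULift.down)

theorem Triple.AtomicEq.sameAtoms {A : Type u} {n : ℕ} {x y : K.Triple A n}
    (h : x.AtomicEq y) : L.SameAtoms x.val y.val := by
  obtain ⟨N, _, f, g, -, -, hA, hp⟩ := h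
  have : f ∘ x.val = g ∘ y.val := by
    funext b
    rcases b with a | i
    · exact hA a
    · exact hp i.down
  have h1 := SameAtoms.comp_embedding f x.val
  rw [this] at h1
  exact h1.trans (SameAtoms.comp_embedding g y.val).symm

/-- Embeddings preserve and reflect atomic formulas, so having the same atoms is an equivalence
relation containing atomic equivalence, hence containing the relation it generates. This holds in
every AEC. -/
theorem sameAtoms_of_mk_eq {A : Type u} {n : ℕ} {x y : K.Triple A n}
    (h : (Quot.mk _ x : K.GType A n) = Quot.mk _ y) : L.SameAtoms x.val y.val := by
  have : ∀ z w : K.Triple A n, Relation.EqvGen Triple.AtomicEq z w →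
      L.SameAtoms z.val w.val := fun z w hzw => by
    induction hzw with
    | rel x y h => exact h.sameAtoms
    | refl x => exact SameAtoms.refl _
    | symm x y _ ih => exact ih.symm
    | trans x y z _ _ ih1 ih2 => exact ih1.trans ih2
  exact this x y (Quot.eqvGen_exact h)

end SameAtoms

/-- Closure properties of a class of structures that is determined by the substructures
generated by triples of elements. -/
structure IsUniversal (Φ : ∀ (M : Type u) [L.Structure M], Prop) : Prop where
  of_embedding : ∀ {M N : Type u} [L.Structure M] [L.Structure N], (M ↪[L] N) → Φ N → Φ M
  of_locally : ∀ {M : Type u} [L.Structure M],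
    (∀ x y z : M, ∃ S : L.Substructure M, x ∈ S ∧ y ∈ S ∧ z ∈ S ∧ Φ S) → Φ M

variable {Φ : ∀ (M : Type u) [L.Structure M], Prop}

/-- Any three elements of the union of a chain already lie in one of its members. -/
theorem IsUniversal.of_iSup (h : IsUniversal Φ) {ι : Type u} [LinearOrder ι] [Nonempty ι]
    {U : Type u} [L.Structure U] {S : ι → L.Substructure U} (hS : Monotone S)
    (hΦ : ∀ i, Φ (S i)) : Φ (⨆ i, S i : L.Substructure U) := by
  refine h.of_locally fun x y z => ?_
  have hd : Directed (· ≤ ·) S := hS.directed_le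
  obtain ⟨i, hi⟩ := (Substructure.mem_iSup_of_directed hd).1 x.2
  obtain ⟨j, hj⟩ := (Substructure.mem_iSup_of_directed hd).1 y.2
  obtain ⟨k, hk⟩ := (Substructure.mem_iSup_of_directed hd).1 z.2
  let m := max i (max j k)
  have him : i ≤ m := le_max_left _ _
  have hjm : j ≤ m := (le_max_left _ _).trans (le_max_right _ _)
  have hkm : k ≤ m := (le_max_right _ _).trans (le_max_right _ _)
  refine ⟨(S m).comap (⨆ i, S i : L.Substructure U).subtype.toHom, hS him hi, hS hjm hj,
    hS hkm hk, ?_⟩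
  refine h.of_embedding (N := S m) (Embedding.codRestrict (S m)
    ((Substructure.subtype _).comp (Substructure.subtype _)) fun c => c.2) (hΦ m)

theorem card_closure_insert_le {N : Type u} [L.Structure N] (A : Set N) (p : N) {μ : Cardinal.{u}}
    (h1 : ℵ₀ ≤ μ) (h2 : L.card ≤ μ) :
    #(Substructure.closure L (insert p A)) ≤ #A + μ := by
  have h := Substructure.lift_card_closure_le (L := L) (s := insert p A)
  simp only [Cardinal.lift_id] at h
  refine h.trans (max_le (h1.trans le_add_self) ?_)
  have h3 : #(Σ i, L.Functions i) ≤ μ := by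
    refine le_trans ?_ h2
    rw [Language.card, Cardinal.mk_sum]
    simp
  calc #(insert p A : Set N) + #(Σ i, L.Functions i) ≤ (#A + 1) + μ :=
        add_le_add (Cardinal.mk_insert_le) h3
    _ = #A + μ := by
        rw [add_assoc, add_comm 1 μ, Cardinal.add_one_eq h1]

/-- The abstract elementary class of the nonempty structures in a universal class, ordered by
being a substructure. -/
def ofUniversal (h : IsUniversal Φ) : AEC L where
  Mem M _ := Nonempty M ∧ Φ M
  Strong {N} _ S := (S : Set N).Nonempty ∧ Φ N
  nonempty_of_mem hM := hM.1
  mem_of_equiv e hM := ⟨hM.1.map e, h.of_embedding e.symm.toEmbedding hM.2⟩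
  strong_of_equiv e S hS :=
    ⟨hS.1.elim fun x hx => ⟨e x, ⟨x, hx, rfl⟩⟩, h.of_embedding e.symm.toEmbedding hS.2⟩
  mem_left S hS := ⟨hS.1.to_subtype, h.of_embedding S.subtype hS.2⟩
  mem_right S hS := ⟨hS.1.elim fun x _ => ⟨x⟩, hS.2⟩
  strong_refl hN := ⟨hN.1.elim fun x => ⟨x, trivial⟩, hN.2⟩
  strong_trans T S hS hT := ⟨hS.1.elim fun x hx => ⟨x, ⟨x, hx, rfl⟩⟩, hT.2⟩
  coherence S T hST hS hT :=
    ⟨hS.1.elim fun x hx => ⟨⟨x, hST hx⟩, hx⟩, h.of_embedding T.subtype hT.2⟩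
  strong_iSup {ι} _ _ _ _ {U} _ S hS hchain := by
    have hΦ : Φ (⨆ i, S i : L.Substructure U) := h.of_iSup hS fun i => (hchain i i le_rfl).2
    have hne : ∀ i, ∃ x, x ∈ S i := fun i =>
      (hchain i i le_rfl).1.elim fun x _ => ⟨x, x.2⟩
    obtain ⟨i₀⟩ : Nonempty ι := inferInstance
    refine ⟨⟨(hne i₀).elim fun x hx => ⟨x, le_iSup S i₀ hx⟩, hΦ⟩, fun i =>
      ⟨(hne i).elim fun x hx => ⟨⟨x, le_iSup S i hx⟩, hx⟩, hΦ⟩⟩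
  iSup_strong {ι} _ _ _ _ {N} _ S hS hchain hstrong := by
    obtain ⟨i₀⟩ : Nonempty ι := inferInstance
    exact ⟨(hstrong i₀).1.elim fun x hx => ⟨x, le_iSup S i₀ hx⟩, (hstrong i₀).2⟩
  exists_lowenheimSkolem := by
    refine ⟨max ℵ₀ L.card, le_max_left _ _, le_max_right _ _, fun {N} _ hN A => ?_⟩
    obtain ⟨p⟩ := hN.1
    exact ⟨Substructure.closure L (insert p A),
      ⟨⟨p, Substructure.subset_closure (Set.mem_insert _ _)⟩, hN.2⟩,
      (Set.subset_insert p A).trans Substructure.subset_closure,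
      card_closure_insert_le A p (le_max_left _ _) (le_max_right _ _)⟩

variable (h : IsUniversal Φ)

theorem ofUniversal_mem {M : Type u} [L.Structure M] :
    (ofUniversal h).Mem M ↔ Nonempty M ∧ Φ M := Iff.rfl

theorem ofUniversal_strong {N : Type u} [L.Structure N] (S : L.Substructure N) :
    (ofUniversal h).Strong S ↔ (S : Set N).Nonempty ∧ Φ N := Iff.rfl

theorem ofUniversal_isEmb {M N : Type u} [L.Structure M] [L.Structure N] (f : M ↪[L] N)
    (hM : Nonempty M) (hN : Φ N) : (ofUniversal h).IsEmb f :=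
  ⟨(ofUniversal_mem h).2 ⟨hM, h.of_embedding f hN⟩, (ofUniversal_mem h).2 ⟨hM.map f, hN⟩,
    (ofUniversal_strong h _).2 ⟨hM.elim fun x => ⟨f x, x, rfl⟩, hN⟩⟩

/-- Generated substructures give the upper bound; the lower bound is built into the definition of
`LS`. The extra generator `p` keeps the substructure nonempty when `A` is empty. -/
theorem ofUniversal_LS (hL : ℵ₀ ≤ L.card) : (ofUniversal h).LS = L.card := by
  apply le_antisymm
  · refine csInf_le' ⟨hL, le_rfl, fun {N} _ hN A => ?_⟩
    obtain ⟨⟨p⟩, hN⟩ := (ofUniversal_mem h).1 hN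
    exact ⟨Substructure.closure L (insert p A), (ofUniversal_strong h _).2
      ⟨⟨p, Substructure.subset_closure (Set.mem_insert _ _)⟩, hN⟩,
      (Set.subset_insert p A).trans Substructure.subset_closure,
      card_closure_insert_le A p hL le_rfl⟩
  · exact le_csInf (ofUniversal h).exists_lowenheimSkolem fun μ hμ => hμ.2.1

variable {h}

/-- Amalgamation is not needed: the substructure generated by the base and the tuple is itself a
model and embeds into both sides, so two atomic equivalences through it link `x` to `y`. -/
theorem mk_eq_of_sameAtoms {A : Type u} {n : ℕ} {x y : (ofUniversal h).Triple A n}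
    (hJ : (ofUniversal h).JEP) (hxy : L.SameAtoms x.val y.val) :
    (Quot.mk _ x : (ofUniversal h).GType A n) = Quot.mk _ y := by
  by_cases hne : Nonempty (A ⊕ ULift.{u} (Fin n))
  · obtain ⟨b₀⟩ := hne
    obtain ⟨hx₀, hx⟩ := (ofUniversal_mem h).1 x.mem
    obtain ⟨hy₀, hy⟩ := (ofUniversal_mem h).1 y.mem
    obtain ⟨g, hg⟩ := hxy.exists_embedding
    let S := Substructure.closure L (Set.range x.val)
    have hmem : ∀ b, x.val b ∈ S := fun b => Substructure.subset_closure ⟨b, rfl⟩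
    have hS : Nonempty S := ⟨⟨x.val b₀, hmem b₀⟩⟩
    have hΦ : Φ S := h.of_embedding S.subtype hx
    let z : (ofUniversal h).Triple A n :=
      { carrier := S
        mem := (ofUniversal_mem h).2 ⟨hS, hΦ⟩
        base := ⟨fun a => ⟨x.base a, hmem (Sum.inl a)⟩, fun a b hab =>
          x.base.injective (congrArg Subtype.val hab)⟩
        pt := fun i => ⟨x.pt i, hmem (Sum.inr ⟨i⟩)⟩ }
    have h1 : z.AtomicEq x := ⟨x.carrier, x.str, S.subtype, Embedding.refl L _,
      ofUniversal_isEmb h _ hS hx, ofUniversal_isEmb h _ hx₀ hx,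
      fun a => rfl, fun i => rfl⟩
    have h2 : z.AtomicEq y := ⟨y.carrier, y.str, g, Embedding.refl L _,
      ofUniversal_isEmb h _ hS hy, ofUniversal_isEmb h _ hy₀ hy,
      fun a => hg (Sum.inl a), fun i => hg (Sum.inr ⟨i⟩)⟩
    exact (Quot.sound h1).symm.trans (Quot.sound h2)
  -- With empty base and empty tuple the generated substructure may be empty, hence not a model;
  -- joint embedding replaces it.
  · obtain ⟨N, i, f, g, hf, hg⟩ := hJ x.mem y.mem
    exact Quot.sound ⟨N, i, f, g, hf, hg, fun a => (hne ⟨Sum.inl a⟩).elim,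
      fun i => (hne ⟨Sum.inr ⟨i⟩⟩).elim⟩

/-- A term over `A ⊕ γ` uses finitely many variables from `A`. -/
theorem exists_finset_term {A γ : Type u} (t : L.Term (A ⊕ γ)) :
    ∃ A₀ : Finset A, ∀ B : Set A, ↑A₀ ⊆ B →
      ∃ t' : L.Term (B ⊕ γ), t'.relabel (Sum.map Subtype.val id) = t := by
  classical
  induction t with
  | var b =>
    rcases b with a | c
    · exact ⟨{a}, fun B hB => ⟨Term.var (Sum.inl ⟨a, hB (by simp)⟩), rfl⟩⟩
    · exact ⟨∅, fun B _ => ⟨Term.var (Sum.inr c), rfl⟩⟩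
  | func f ts ih =>
    choose A₀ hA₀ using ih
    refine ⟨Finset.univ.biUnion A₀, fun B hB => ?_⟩
    choose ts' hts' using fun i => hA₀ i B (subset_trans (by
      intro a ha
      simp only [Finset.coe_biUnion, Set.mem_iUnion]
      exact ⟨i, by simp, ha⟩) hB)
    refine ⟨Term.func f ts', ?_⟩
    simp [Term.relabel, hts']

theorem Triple.val_restrict {K : AEC L} {A : Type u} {n : ℕ} (x : K.Triple A n) (B : Set A) :
    (x.restrict B).val = x.val ∘ Sum.map Subtype.val id := by
  funext b
  rcases b with a | i <;> rfl

/-- An atomic formula mentions only finitely many parameters, and Galois types are atomic types. -/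
theorem ofUniversal_tame (hJ : (ofUniversal h).JEP) : (ofUniversal h).Tame ℵ₀ := by
  classical
  intro A k _ p q hpq
  induction p using Quot.ind with | _ x =>
  induction q using Quot.ind with | _ y =>
  by_contra! hcon
  apply hpq
  have hfin : ∀ A₀ : Finset A, L.SameAtoms (x.val ∘ Sum.map (Subtype.val : ((A₀ : Set A) : Type u) → A) id)
      (y.val ∘ Sum.map (Subtype.val : ((A₀ : Set A) : Type u) → A) id) := fun A₀ => by
    have h1 := hcon (A₀ : Set A) (Cardinal.lt_aleph0_of_finite _)
    have h2 := sameAtoms_of_mk_eq (x := x.restrict A₀) (y := y.restrict A₀) h1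
    rwa [Triple.val_restrict, Triple.val_restrict] at h2
  refine mk_eq_of_sameAtoms hJ ⟨fun s t => ?_, fun {n} R ts => ?_⟩
  · obtain ⟨A₁, h1⟩ := exists_finset_term s
    obtain ⟨A₂, h2⟩ := exists_finset_term t
    obtain ⟨s', rfl⟩ := h1 (A₁ ∪ A₂ : Finset A) (by simp)
    obtain ⟨t', rfl⟩ := h2 (A₁ ∪ A₂ : Finset A) (by simp)
    simp only [Term.realize_relabel]
    exact (hfin (A₁ ∪ A₂)).eq_iff s' t'
  · choose A₀ hA₀ using fun i => exists_finset_term (ts i)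
    choose ts' hts' using fun i => hA₀ i (Finset.univ.biUnion A₀ : Finset A) (by
      intro a ha
      simp only [Finset.coe_biUnion, Set.mem_iUnion]
      exact ⟨i, by simp, ha⟩)
    obtain rfl : (fun i => (ts' i).relabel (Sum.map Subtype.val id)) = ts := funext hts'
    simp only [Term.realize_relabel]
    exact (hfin (Finset.univ.biUnion A₀)).rel_iff R ts'

end AEC

/-! ### Arithmetic of the beth function -/

theorem bethFrom_zero (κ : Cardinal.{u}) : bethFrom κ 0 = κ := by
  simp [bethFrom]

theorem bethFrom_succ (κ : Cardinal.{u}) (β : Ordinal.{u}) :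
    bethFrom κ (Order.succ β) = 2 ^ bethFrom κ β := by
  rw [Order.succ_eq_add_one]
  simp [bethFrom]

theorem bethFrom_limit (κ : Cardinal.{u}) {δ : Ordinal.{u}} (hδ : Order.IsSuccLimit δ) :
    bethFrom κ δ = ⨆ β : Set.Iio δ, bethFrom κ β := by
  simp only [bethFrom]
  rw [Ordinal.limitRecOn_limit _ _ _ _ hδ]

theorem bethFrom_le_limit (κ : Cardinal.{u}) {β δ : Ordinal.{u}} (hδ : Order.IsSuccLimit δ)
    (h : β < δ) : bethFrom κ β ≤ bethFrom κ δ := by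
  rw [bethFrom_limit κ hδ]
  exact le_ciSup (Cardinal.bddAbove_of_small) (⟨β, h⟩ : Set.Iio δ)

theorem bethFrom_strictMono (κ : Cardinal.{u}) : StrictMono (bethFrom κ) := by
  intro β γ hβγ
  induction γ using Ordinal.limitRecOn with
  | zero => exact absurd hβγ not_lt_zero
  | add_one γ ih =>
    rw [← Order.succ_eq_add_one, bethFrom_succ]
    rcases (Order.lt_add_one_iff.1 hβγ).lt_or_eq with h | rfl
    · exact (ih h).trans (Cardinal.cantor _)
    · exact Cardinal.cantor _
  | limit γ hγ ih =>
    have h1 := hγ.succ_lt hβγ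
    exact (ih _ h1 (Order.lt_succ β)).trans_le (bethFrom_le_limit κ hγ h1)

theorem le_bethFrom (κ : Cardinal.{u}) (β : Ordinal.{u}) : κ ≤ bethFrom κ β := by
  conv_lhs => rw [← bethFrom_zero κ]
  exact (bethFrom_strictMono κ).monotone zero_le

theorem card_le_bethFrom (κ : Cardinal.{u}) (β : Ordinal.{u}) : β.card ≤ bethFrom κ β := by
  have h : StrictMono fun β => (bethFrom κ β).ord :=
    Cardinal.ord_strictMono.comp (bethFrom_strictMono κ)
  simpa using Ordinal.card_le_card (h.le_apply (x := β))

/-! ### The class of labelled hierarchies -/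

/-- The function symbols of the language of labelled hierarchies. -/
inductive HierFunctions : ℕ → Type u
  | wit : HierFunctions 2

/-- The relation symbols of the language of labelled hierarchies. -/
inductive HierRelations (Γ : Type u) : ℕ → Type u
  | lab (γ : Γ) : HierRelations Γ 1
  | sim : HierRelations Γ 2
  | mem : HierRelations Γ 2
  | lt : HierRelations Γ 2

/-- The language of labelled hierarchies: unary predicates indexed by `Γ`, an equivalence relation
`sim`, relations `mem` and `lt`, and a binary function `wit`. -/
def hierLang (Γ : Type u) : FirstOrder.Language.{u, u} := ⟨HierFunctions, HierRelations Γ⟩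

namespace Hier

open FirstOrder.Language Structure

variable {Γ : Type u}

theorem card_functions : #(Σ n, (hierLang Γ).Functions n) = 1 := by
  refine Cardinal.eq_one_iff_unique.2 ⟨⟨?_⟩, ⟨⟨2, HierFunctions.wit⟩⟩⟩
  rintro ⟨_, _ | _⟩ ⟨_, _ | _⟩
  rfl

theorem card_relations : #(Σ n, (hierLang Γ).Relations n) = #Γ + 3 := by
  have e : (Σ n, (hierLang Γ).Relations n) ≃ Γ ⊕ ULift.{u} (Fin 3) :=
    { toFun := fun x => match x with
        | ⟨_, .lab γ⟩ => .inl γ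
        | ⟨_, .sim⟩ => .inr ⟨0⟩
        | ⟨_, .mem⟩ => .inr ⟨1⟩
        | ⟨_, .lt⟩ => .inr ⟨2⟩
      invFun := fun y => match y with
        | .inl γ => ⟨1, .lab γ⟩
        | .inr ⟨0⟩ => ⟨2, .sim⟩
        | .inr ⟨1⟩ => ⟨2, .mem⟩
        | .inr ⟨2⟩ => ⟨2, .lt⟩
      left_inv := by rintro ⟨_, _ | _ | _ | _⟩ <;> rfl
      right_inv := by
        rintro (γ | ⟨i⟩)
        · rfl
        · fin_cases i <;> rfl }
  rw [Cardinal.mk_congr e]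
  simp

theorem card_hierLang (hΓ : ℵ₀ ≤ #Γ) : (hierLang Γ).card = #Γ := by
  have h : (hierLang Γ).card =
      #(Σ n, (hierLang Γ).Functions n) + #(Σ n, (hierLang Γ).Relations n) := by
    simp [Language.card, Cardinal.mk_sum]
  rw [h, card_functions, card_relations, ← add_assoc, add_comm 1, add_assoc]
  exact Cardinal.add_eq_left hΓ ((Cardinal.natCast_lt_aleph0 (n := 4)).le.trans hΓ |>.trans' (by norm_num))

/-- The symbol of the unary predicate with index `γ`. -/
abbrev labSymb (γ : Γ) : (hierLang Γ).Relations 1 := HierRelations.lab γ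

variable (Γ) in
/-- The symbol of the component relation. -/
abbrev simSymb : (hierLang Γ).Relations 2 := HierRelations.sim

variable (Γ) in
/-- The symbol of the membership relation. -/
abbrev memSymb : (hierLang Γ).Relations 2 := HierRelations.mem

variable (Γ) in
/-- The symbol of the auxiliary order relation. -/
abbrev ltSymb : (hierLang Γ).Relations 2 := HierRelations.lt

variable (Γ) in
/-- The symbol of the witness function. -/
abbrev witSymb : (hierLang Γ).Functions 2 := HierFunctions.wit

section Basic

variable {M : Type u} [(hierLang Γ).Structure M]

variable (Γ)

/-- The equivalence relation of belonging to the same component. -/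
def Sim (x y : M) : Prop := RelMap (simSymb Γ) ![x, y]

/-- The membership relation. -/
def Mem (x y : M) : Prop := RelMap (memSymb Γ) ![x, y]

/-- The auxiliary order relation. -/
def Lt (x y : M) : Prop := RelMap (ltSymb Γ) ![x, y]

/-- The witness function. -/
def wit (x y : M) : M := funMap (witSymb Γ) ![x, y]

/-- The label of an element: the set of unary predicates it satisfies. -/
def lab (x : M) : Set Γ := {γ | RelMap (labSymb γ) ![x]}

variable {Γ}

theorem eq_vec_one {X : Type*} (v : Fin 1 → X) : v = ![v 0] := by
  funext i; fin_cases i; rfl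

theorem eq_vec_two {X : Type*} (v : Fin 2 → X) : v = ![v 0, v 1] := by
  funext i; fin_cases i <;> rfl

theorem relMap_sim (v : Fin 2 → M) :
    RelMap (simSymb Γ) v ↔ Sim Γ (v 0) (v 1) := by
  rw [Sim, ← eq_vec_two]

theorem relMap_mem (v : Fin 2 → M) :
    RelMap (memSymb Γ) v ↔ Mem Γ (v 0) (v 1) := by
  rw [Mem, ← eq_vec_two]

theorem relMap_lt (v : Fin 2 → M) :
    RelMap (ltSymb Γ) v ↔ Lt Γ (v 0) (v 1) := by
  rw [Lt, ← eq_vec_two]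

theorem funMap_wit (v : Fin 2 → M) :
    funMap (witSymb Γ) v = wit Γ (v 0) (v 1) := by
  rw [wit, ← eq_vec_two]

theorem relMap_lab (γ : Γ) (v : Fin 1 → M) :
    RelMap (labSymb γ) v ↔ γ ∈ lab Γ (v 0) := by
  rw [lab, Set.mem_ofPred_eq, ← eq_vec_one]

variable {N : Type u} [(hierLang Γ).Structure N]

section Embedding

variable (f : M ↪[hierLang Γ] N) (x y : M)

theorem sim_map : Sim Γ (f x) (f y) ↔ Sim Γ x y :=
  (relMap_sim (f ∘ ![x, y])).symm.trans (f.map_rel _ _)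

theorem mem_map : Mem Γ (f x) (f y) ↔ Mem Γ x y :=
  (relMap_mem (f ∘ ![x, y])).symm.trans (f.map_rel _ _)

theorem lt_map : Lt Γ (f x) (f y) ↔ Lt Γ x y :=
  (relMap_lt (f ∘ ![x, y])).symm.trans (f.map_rel _ _)

theorem wit_map : wit Γ (f x) (f y) = f (wit Γ x y) :=
  (funMap_wit (f ∘ ![x, y])).symm.trans (f.map_fun _ _).symm

theorem lab_map : lab Γ (f x) = lab Γ x := by
  ext γ
  exact (relMap_lab γ (f ∘ ![x])).symm.trans (f.map_rel _ _)

end Embedding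

/-- An injection that preserves labels, relations and witnesses is an embedding. -/
def mkEmbedding (f : M → N) (hf : Function.Injective f)
    (hsim : ∀ x y, Sim Γ (f x) (f y) ↔ Sim Γ x y) (hmem : ∀ x y, Mem Γ (f x) (f y) ↔ Mem Γ x y)
    (hlt : ∀ x y, Lt Γ (f x) (f y) ↔ Lt Γ x y) (hwit : ∀ x y, wit Γ (f x) (f y) = f (wit Γ x y))
    (hlab : ∀ x, lab Γ (f x) = lab Γ x) : M ↪[hierLang Γ] N where
  toFun := f
  inj' := hf
  map_fun' := by
    rintro _ (_ | _) v
    exact (congrArg f (funMap_wit v)).trans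
      ((hwit _ _).symm.trans (funMap_wit (f ∘ v)).symm)
  map_rel' := by
    rintro _ (γ | _ | _ | _) v
    · exact (relMap_lab γ (f ∘ v)).trans ((Set.ext_iff.1 (hlab (v 0)) γ).trans (relMap_lab γ v).symm)
    · exact (relMap_sim (f ∘ v)).trans ((hsim _ _).trans (relMap_sim v).symm)
    · exact (relMap_mem (f ∘ v)).trans ((hmem _ _).trans (relMap_mem v).symm)
    · exact (relMap_lt (f ∘ v)).trans ((hlt _ _).trans (relMap_lt v).symm)

end Basic

/-- A structure for the language of labelled hierarchies, given by its relations. -/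
@[reducible]
def mkStructure {X : Type u} (sim mem lt : X → X → Prop) (wit : X → X → X) (lab : X → Set Γ) :
    (hierLang Γ).Structure X where
  funMap {_} f := match f with
    | .wit => fun v => wit (v 0) (v 1)
  RelMap {_} r := match r with
    | .lab γ => fun v => γ ∈ lab (v 0)
    | .sim => fun v => sim (v 0) (v 1)
    | .mem => fun v => mem (v 0) (v 1)
    | .lt => fun v => lt (v 0) (v 1)

/-- Labelled hierarchies: every component is extensional, in the sense that distinct elements with
the same label are distinguished by a member, given by `wit`, whose label has smaller rank. -/
structure IsHier (ρ : Set Γ → Ordinal.{u}) (M : Type u) [(hierLang Γ).Structure M] : Prop where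
  refl : ∀ x : M, Sim Γ x x
  symm : ∀ x y : M, Sim Γ x y → Sim Γ y x
  trans : ∀ x y z : M, Sim Γ x y → Sim Γ y z → Sim Γ x z
  sim_of_mem : ∀ x y : M, Mem Γ x y → Sim Γ x y
  sim_of_lt : ∀ x y : M, Lt Γ x y → Sim Γ x y
  wit_sim : ∀ x y : M, Sim Γ (wit Γ x y) x
  wit_of_not_sim : ∀ x y : M, ¬ Sim Γ x y → wit Γ x y = x
  rank_wit_lt : ∀ x y : M, Sim Γ x y → x ≠ y → lab Γ x = lab Γ y →
    ρ (lab Γ (wit Γ x y)) < ρ (lab Γ x)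
  mem_wit : ∀ x y : M, Sim Γ x y → x ≠ y → lab Γ x = lab Γ y →
    ¬ (Mem Γ (wit Γ x y) x ↔ Mem Γ (wit Γ x y) y)

variable (ρ : Set Γ → Ordinal.{u})

theorem IsHier.of_embedding {M N : Type u} [(hierLang Γ).Structure M] [(hierLang Γ).Structure N]
    (f : M ↪[hierLang Γ] N) (h : IsHier ρ N) : IsHier ρ M where
  refl x := (sim_map f _ _).1 (h.refl _)
  symm x y hxy := (sim_map f _ _).1 (h.symm _ _ ((sim_map f _ _).2 hxy))
  trans x y z hxy hyz := (sim_map f _ _).1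
    (h.trans _ _ _ ((sim_map f _ _).2 hxy) ((sim_map f _ _).2 hyz))
  sim_of_mem x y hxy := (sim_map f _ _).1 (h.sim_of_mem _ _ ((mem_map f _ _).2 hxy))
  sim_of_lt x y hxy := (sim_map f _ _).1 (h.sim_of_lt _ _ ((lt_map f _ _).2 hxy))
  wit_sim x y := (sim_map f _ _).1 (wit_map f x y ▸ h.wit_sim _ _)
  wit_of_not_sim x y hxy := f.injective
    ((wit_map f x y).symm.trans (h.wit_of_not_sim _ _ fun h' => hxy ((sim_map f _ _).1 h')))
  rank_wit_lt x y hs hne hl := by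
    have := h.rank_wit_lt (f x) (f y) ((sim_map f _ _).2 hs) (f.injective.ne hne)
      (by rw [lab_map, lab_map, hl])
    rwa [wit_map, lab_map, lab_map] at this
  mem_wit x y hs hne hl := by
    have := h.mem_wit (f x) (f y) ((sim_map f _ _).2 hs) (f.injective.ne hne)
      (by rw [lab_map, lab_map, hl])
    rwa [wit_map, mem_map, mem_map] at this

/-- Thanks to the function `wit`, extensionality has no existential quantifier. Every axiom is then
a universal condition on at most three elements; transitivity of `Sim` is the one that needs three.
-/
theorem isUniversal : AEC.IsUniversal (fun (M : Type u) [(hierLang Γ).Structure M] =>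
    IsHier ρ M) where
  of_embedding f h := h.of_embedding ρ f
  of_locally {M} _ hloc := by
    have key : ∀ x y z : M, ∃ (S : (hierLang Γ).Substructure M) (x' y' z' : S),
        S.subtype x' = x ∧ S.subtype y' = y ∧ S.subtype z' = z ∧ IsHier ρ S := fun x y z => by
      obtain ⟨S, hx, hy, hz, hS⟩ := hloc x y z
      exact ⟨S, ⟨x, hx⟩, ⟨y, hy⟩, ⟨z, hz⟩, rfl, rfl, rfl, hS⟩
    constructor
    · intro x
      obtain ⟨S, x, -, -, rfl, -, -, h⟩ := key x x x
      exact (sim_map S.subtype _ _).2 (h.refl _)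
    · intro x y hxy
      obtain ⟨S, x, y, -, rfl, rfl, -, h⟩ := key x y y
      rw [sim_map] at hxy ⊢
      exact h.symm _ _ hxy
    · intro x y z hxy hyz
      obtain ⟨S, x, y, z, rfl, rfl, rfl, h⟩ := key x y z
      rw [sim_map] at hxy hyz ⊢
      exact h.trans _ _ _ hxy hyz
    · intro x y hxy
      obtain ⟨S, x, y, -, rfl, rfl, -, h⟩ := key x y y
      rw [mem_map] at hxy
      rw [sim_map]
      exact h.sim_of_mem _ _ hxy
    · intro x y hxy
      obtain ⟨S, x, y, -, rfl, rfl, -, h⟩ := key x y y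
      rw [lt_map] at hxy
      rw [sim_map]
      exact h.sim_of_lt _ _ hxy
    · intro x y
      obtain ⟨S, x, y, -, rfl, rfl, -, h⟩ := key x y y
      rw [wit_map, sim_map]
      exact h.wit_sim _ _
    · intro x y hxy
      obtain ⟨S, x, y, -, rfl, rfl, -, h⟩ := key x y y
      rw [sim_map] at hxy
      rw [wit_map, h.wit_of_not_sim _ _ hxy]
    · intro x y hxy hne hl
      obtain ⟨S, x, y, -, rfl, rfl, -, h⟩ := key x y y
      rw [sim_map] at hxy
      rw [lab_map, lab_map] at hl
      rw [wit_map, lab_map, lab_map]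
      exact h.rank_wit_lt _ _ hxy (fun h' => hne (by rw [h'])) hl
    · intro x y hxy hne hl
      obtain ⟨S, x, y, -, rfl, rfl, -, h⟩ := key x y y
      rw [sim_map] at hxy
      rw [lab_map, lab_map] at hl
      rw [wit_map, mem_map, mem_map]
      exact h.mem_wit _ _ hxy (fun h' => hne (by rw [h'])) hl

/-- The class of labelled hierarchies with the substructure relation. -/
def hierAEC : AEC (hierLang Γ) := AEC.ofUniversal (isUniversal ρ)

theorem mem_hierAEC {M : Type u} [(hierLang Γ).Structure M] :
    (hierAEC ρ).Mem M ↔ Nonempty M ∧ IsHier ρ M := Iff.rfl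

section Sum

variable (M₁ M₂ : Type u) [(hierLang Γ).Structure M₁] [(hierLang Γ).Structure M₂]

/-- The disjoint union of two labelled hierarchies. -/
instance sumStructure : (hierLang Γ).Structure (M₁ ⊕ M₂) :=
  mkStructure (Sum.LiftRel (Sim Γ) (Sim Γ)) (Sum.LiftRel (Mem Γ) (Mem Γ))
    (Sum.LiftRel (Lt Γ) (Lt Γ))
    (fun p q => match p, q with
      | .inl x, .inl y => .inl (wit Γ x y)
      | .inr x, .inr y => .inr (wit Γ x y)
      | p, _ => p)
    (Sum.elim (lab Γ) (lab Γ))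

variable {M₁ M₂}

variable (Γ M₁ M₂) in
/-- The left inclusion into a disjoint union. -/
def inlEmbedding : M₁ ↪[hierLang Γ] M₁ ⊕ M₂ :=
  mkEmbedding Sum.inl Sum.inl_injective (fun _ _ => Sum.liftRel_inl_inl)
    (fun _ _ => Sum.liftRel_inl_inl) (fun _ _ => Sum.liftRel_inl_inl) (fun _ _ => rfl)
    (fun _ => rfl)

variable (Γ M₁ M₂) in
/-- The right inclusion into a disjoint union. -/
def inrEmbedding : M₂ ↪[hierLang Γ] M₁ ⊕ M₂ :=
  mkEmbedding Sum.inr Sum.inr_injective (fun _ _ => Sum.liftRel_inr_inr)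
    (fun _ _ => Sum.liftRel_inr_inr) (fun _ _ => Sum.liftRel_inr_inr) (fun _ _ => rfl)
    (fun _ => rfl)

variable {ρ} in
theorem IsHier.sum (h₁ : IsHier ρ M₁) (h₂ : IsHier ρ M₂) : IsHier ρ (M₁ ⊕ M₂) where
  refl := by
    rintro (x | x)
    · exact .inl (h₁.refl x)
    · exact .inr (h₂.refl x)
  symm := by
    rintro _ _ (h | h)
    · exact .inl (h₁.symm _ _ h)
    · exact .inr (h₂.symm _ _ h)
  trans := by
    rintro _ _ _ (h | h) (h' | h')
    · exact .inl (h₁.trans _ _ _ h h')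
    · exact .inr (h₂.trans _ _ _ h h')
  sim_of_mem := by
    rintro _ _ (h | h)
    · exact .inl (h₁.sim_of_mem _ _ h)
    · exact .inr (h₂.sim_of_mem _ _ h)
  sim_of_lt := by
    rintro _ _ (h | h)
    · exact .inl (h₁.sim_of_lt _ _ h)
    · exact .inr (h₂.sim_of_lt _ _ h)
  wit_sim := by
    rintro (x | x) (y | y)
    · exact .inl (h₁.wit_sim x y)
    · exact .inl (h₁.refl x)
    · exact .inr (h₂.refl x)
    · exact .inr (h₂.wit_sim x y)
  wit_of_not_sim := by
    rintro (x | x) (y | y) h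
    · exact congrArg Sum.inl (h₁.wit_of_not_sim x y fun h' => h (.inl h'))
    · rfl
    · rfl
    · exact congrArg Sum.inr (h₂.wit_of_not_sim x y fun h' => h (.inr h'))
  rank_wit_lt := by
    rintro _ _ (h | h) hne hl
    · exact h₁.rank_wit_lt _ _ h (fun h' => hne (congrArg _ h')) hl
    · exact h₂.rank_wit_lt _ _ h (fun h' => hne (congrArg _ h')) hl
  mem_wit := by
    rintro _ _ (h | h) hne hl h'
    · exact h₁.mem_wit _ _ h (fun h' => hne (congrArg _ h')) hl
        (Sum.liftRel_inl_inl.symm.trans (h'.trans Sum.liftRel_inl_inl))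
    · exact h₂.mem_wit _ _ h (fun h' => hne (congrArg _ h')) hl
        (Sum.liftRel_inr_inr.symm.trans (h'.trans Sum.liftRel_inr_inr))

end Sum

theorem hierAEC_JEP : (hierAEC ρ).JEP := by
  intro M₁ M₂ _ _ h₁ h₂
  rw [mem_hierAEC] at h₁ h₂
  have h := h₁.2.sum h₂.2
  exact ⟨M₁ ⊕ M₂, inferInstance, inlEmbedding Γ M₁ M₂, inrEmbedding Γ M₁ M₂,
    AEC.ofUniversal_isEmb _ _ h₁.1 h, AEC.ofUniversal_isEmb _ _ h₂.1 h⟩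

/-- The number of components is unrestricted, so a second copy of the model can be added beside it.
-/
theorem hierAEC_NMM : (hierAEC ρ).NMM := by
  intro M _ hM
  rw [mem_hierAEC] at hM
  refine ⟨M ⊕ M, inferInstance, inlEmbedding Γ M M,
    AEC.ofUniversal_isEmb _ _ hM.1 (hM.2.sum hM.2), fun hs => ?_⟩
  obtain ⟨x⟩ := hM.1
  obtain ⟨y, hy⟩ := hs (.inr x)
  exact Sum.inl_ne_inr hy

theorem hierAEC_tame : (hierAEC ρ).Tame ℵ₀ := AEC.ofUniversal_tame (hierAEC_JEP ρ)

theorem hierAEC_LS (hΓ : ℵ₀ ≤ #Γ) : (hierAEC ρ).LS = #Γ := by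
  have h := card_hierLang hΓ
  rw [← h]
  exact AEC.ofUniversal_LS _ (h.symm ▸ hΓ)

end Hier

/-! ### Size of components and stability above the bound -/

namespace FirstOrder.Language

open Structure

variable {L : Language.{u, u}} {M : Type u} [L.Structure M] {β : Type u}

theorem sameAtoms_of_realize_iff {v w : β → M}
    (h : ∀ φ : L.Formula β, φ.Realize v ↔ φ.Realize w) : L.SameAtoms v w := by
  refine ⟨fun s t => ?_, fun R ts => ?_⟩
  · simpa only [Formula.realize_equal] using h (s.equal t)
  · simpa only [Formula.realize_rel] using h (R.formula ts)

theorem card_formula_le : #(L.Formula β) ≤ max ℵ₀ (#β + L.card) := by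
  have h := BoundedFormula.card_le (L := L) (α := β)
  simp only [Cardinal.lift_id] at h
  refine le_trans ?_ h
  exact Cardinal.mk_le_of_injective (f := fun φ : L.Formula β =>
    (⟨0, φ⟩ : Σ n, L.BoundedFormula β n)) fun φ ψ h => by simpa using h

end FirstOrder.Language

namespace Hier

open FirstOrder.Language Structure

variable {Γ : Type u} {ρ : Set Γ → Ordinal.{u}} {M : Type u} [(hierLang Γ).Structure M]

/-- A component of a labelled hierarchy has at most `ℶ_β` elements of rank less than `β`. -/
theorem IsHier.card_rank_lt_le (h : IsHier ρ M) (hΓ : ℵ₀ ≤ #Γ) (m : M) (β : Ordinal.{u}) :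
    #{x : M | Sim Γ x m ∧ ρ (lab Γ x) < β} ≤ bethFrom #Γ β := by
  induction β using Ordinal.limitRecOn with
  | zero =>
    have : {x : M | Sim Γ x m ∧ ρ (lab Γ x) < 0} = ∅ := by
      ext x
      simp
    rw [this]
    simp
  | add_one β ih =>
    rw [← Order.succ_eq_add_one, bethFrom_succ]
    set S := {x : M | Sim Γ x m ∧ ρ (lab Γ x) < β} with hS
    have hβ : ℵ₀ ≤ bethFrom #Γ β := hΓ.trans (le_bethFrom _ _)
    have hsub : {x : M | Sim Γ x m ∧ ρ (lab Γ x) < Order.succ β} ⊆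
        S ∪ {x : M | Sim Γ x m ∧ ρ (lab Γ x) = β} := by
      rintro x ⟨h1, h2⟩
      rcases (Order.lt_succ_iff.1 h2).lt_or_eq with h3 | h3
      · exact Or.inl ⟨h1, h3⟩
      · exact Or.inr ⟨h1, h3⟩
    have hlev : #{x : M | Sim Γ x m ∧ ρ (lab Γ x) = β} ≤ 2 ^ bethFrom #Γ β := by
      -- By extensionality, an element of rank `β` is determined by its label together with its
      -- members of rank below `β`: the witness separating two such elements has rank below `β`.
      have hinj : Function.Injective
          (fun x : {x : M | Sim Γ x m ∧ ρ (lab Γ x) = β} =>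
            ((lab Γ x.1, {z : S | Mem Γ z.1 x.1}) : Set Γ × Set S)) := by
        rintro ⟨x, hx, hxβ⟩ ⟨y, hy, hyβ⟩ hxy
        simp only [Prod.mk.injEq] at hxy
        by_contra hne
        have hne' : x ≠ y := fun h' => hne (Subtype.ext h')
        have hsim : Sim Γ x y := h.trans _ _ _ hx (h.symm _ _ hy)
        refine h.mem_wit x y hsim hne' hxy.1 ?_
        have hw : wit Γ x y ∈ S := ⟨h.trans _ _ _ (h.wit_sim x y) hx,
          hxβ ▸ h.rank_wit_lt x y hsim hne' hxy.1⟩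
        exact Set.ext_iff.1 hxy.2 ⟨_, hw⟩
      refine (Cardinal.mk_le_of_injective hinj).trans ?_
      rw [Cardinal.mk_prod, Cardinal.lift_id, Cardinal.lift_id, Cardinal.mk_set, Cardinal.mk_set,
        ← Cardinal.power_add]
      refine Cardinal.power_le_power_left two_ne_zero ?_
      exact (add_le_add (le_bethFrom _ _) ih).trans (Cardinal.add_eq_self hβ).le
    calc #{x : M | Sim Γ x m ∧ ρ (lab Γ x) < Order.succ β}
        ≤ #S + #{x : M | Sim Γ x m ∧ ρ (lab Γ x) = β} :=
          (Cardinal.mk_le_mk_of_subset hsub).trans (Cardinal.mk_union_le _ _)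
      _ ≤ 2 ^ bethFrom #Γ β + 2 ^ bethFrom #Γ β :=
          add_le_add (ih.trans (Cardinal.cantor _).le) hlev
      _ = 2 ^ bethFrom #Γ β := Cardinal.add_eq_self (hβ.trans (Cardinal.cantor _).le)
  | limit δ hδ ih =>
    have hδ0 : ℵ₀ ≤ bethFrom #Γ δ := hΓ.trans (le_bethFrom _ _)
    have hsub : {x : M | Sim Γ x m ∧ ρ (lab Γ x) < δ} ⊆
        ⋃ i : δ.ToType, {x : M | Sim Γ x m ∧ ρ (lab Γ x) < Order.succ i.toOrd.1} := by
      rintro x ⟨h1, h2⟩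
      refine Set.mem_iUnion.2 ⟨Ordinal.ToType.mk ⟨_, h2⟩, h1, ?_⟩
      simp
    -- The union has `|δ| ≤ ℶ_δ` terms, each of size at most `ℶ_δ`.
    refine (Cardinal.mk_le_mk_of_subset hsub).trans ((Cardinal.mk_iUnion_le _).trans ?_)
    rw [Cardinal.mk_toType]
    refine (mul_le_mul' (card_le_bethFrom #Γ δ) (ciSup_le' fun i => ?_)).trans
      (Cardinal.mul_eq_self hδ0).le
    have hi : Order.succ i.toOrd.1 < δ := hδ.succ_lt i.toOrd.2
    exact (ih _ hi).trans (bethFrom_le_limit _ hδ hi)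

/-- The tuple consisting of the elements of `A` and of `a`. -/
def extend (A : Set M) (a : M) : A ⊕ ULift.{u} (Fin 1) → M := Sum.elim Subtype.val fun _ => a

theorem realize_wit {β : Type u} (ts : Fin 2 → (hierLang Γ).Term β) (v : β → M) :
    (Term.func (witSymb Γ) ts).realize v = wit Γ ((ts 0).realize v) ((ts 1).realize v) :=
  funMap_wit _

theorem IsHier.term_sim (h : IsHier ρ M) (a : M) (t : (hierLang Γ).Term (ULift.{u} (Fin 1))) :
    Sim Γ (t.realize fun _ => a) a := by
  induction t with
  | var i => exact h.refl a
  | func f ts ih =>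
    cases f
    change Sim Γ (Term.realize _ (Term.func (witSymb Γ) ts)) a
    rw [realize_wit]
    exact h.trans _ _ _ (h.wit_sim _ _) (ih 0)

/-- Terms cannot mix components: `wit` stays in the component of its first argument and returns that
argument when the second lies elsewhere. So a term with parameters in `A` either takes a value near
`A` that is the same for `a` and `b`, or reduces to a parameter-free term in the new element. -/
theorem IsHier.term_extend (h : IsHier ρ M) {A : Set M} {a b : M} (ha : ∀ x ∈ A, ¬ Sim Γ a x)
    (hb : ∀ x ∈ A, ¬ Sim Γ b x) (t : (hierLang Γ).Term (A ⊕ ULift.{u} (Fin 1))) :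
    (∃ c : M, (∃ x ∈ A, Sim Γ c x) ∧ t.realize (extend A a) = c ∧ t.realize (extend A b) = c) ∨
      ∃ s : (hierLang Γ).Term (ULift.{u} (Fin 1)),
        t.realize (extend A a) = s.realize (fun _ => a) ∧
        t.realize (extend A b) = s.realize fun _ => b := by
  have key : ∀ {e c x : M} (s : (hierLang Γ).Term (ULift.{u} (Fin 1))),
      (∀ x ∈ A, ¬ Sim Γ e x) → x ∈ A → Sim Γ c x → ¬ Sim Γ (s.realize fun _ => e) c :=
    fun {e c x} s he hx hc h' =>
      he x hx (h.trans _ _ _ (h.symm _ _ (h.term_sim e s)) (h.trans _ _ _ h' hc))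
  induction t with
  | var i =>
    rcases i with x | i
    · exact Or.inl ⟨x, ⟨x, x.2, h.refl _⟩, rfl, rfl⟩
    · exact Or.inr ⟨Term.var i, rfl, rfl⟩
  | func f ts ih =>
    cases f
    change (∃ c, _ ∧ Term.realize _ (Term.func (witSymb Γ) ts) = c ∧
      Term.realize _ (Term.func (witSymb Γ) ts) = c) ∨ ∃ s,
      Term.realize _ (Term.func (witSymb Γ) ts) = _ ∧
      Term.realize _ (Term.func (witSymb Γ) ts) = _
    simp only [realize_wit]
    rcases ih 0 with ⟨c, ⟨x, hx, hc⟩, h0a, h0b⟩ | ⟨s, h0a, h0b⟩ <;>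
    rcases ih 1 with ⟨d, ⟨y, hy, hd⟩, h1a, h1b⟩ | ⟨t, h1a, h1b⟩ <;>
    rw [h0a, h0b, h1a, h1b]
    · exact Or.inl ⟨_, ⟨x, hx, h.trans _ _ _ (h.wit_sim _ _) hc⟩, rfl, rfl⟩
    · refine Or.inl ⟨c, ⟨x, hx, hc⟩, h.wit_of_not_sim _ _ fun h' => ?_,
        h.wit_of_not_sim _ _ fun h' => ?_⟩
      · exact key t ha hx hc (h.symm _ _ h')
      · exact key t hb hx hc (h.symm _ _ h')
    · exact Or.inr ⟨s, h.wit_of_not_sim _ _ (key s ha hy hd), h.wit_of_not_sim _ _ (key s hb hy hd)⟩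
    · exact Or.inr ⟨Term.func (witSymb Γ) ![s, t],
        (realize_wit ![s, t] fun _ => a).symm, (realize_wit ![s, t] fun _ => b).symm⟩

/-- The atomic type over `A` of an element outside the components of the elements of `A` is
determined by its atomic type over the empty set. -/
theorem IsHier.sameAtoms_extend (h : IsHier ρ M) {A : Set M} {a b : M}
    (ha : ∀ x ∈ A, ¬ Sim Γ a x) (hb : ∀ x ∈ A, ¬ Sim Γ b x)
    (hab : (hierLang Γ).SameAtoms (fun _ : ULift.{u} (Fin 1) => a) fun _ => b) :
    (hierLang Γ).SameAtoms (extend A a) (extend A b) := by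
  have key : ∀ {e c x : M} (s : (hierLang Γ).Term (ULift.{u} (Fin 1))),
      (∀ x ∈ A, ¬ Sim Γ e x) → x ∈ A → Sim Γ c x → ¬ Sim Γ (s.realize fun _ => e) c :=
    fun {e c x} s he hx hc h' =>
      he x hx (h.trans _ _ _ (h.symm _ _ (h.term_sim e s)) (h.trans _ _ _ h' hc))
  -- Equality, `Sim`, `Mem` and `Lt` all hold only within a component, so one argument treats them
  -- together: between a value near `A` and a value near the new element each of them is false.
  have binary : ∀ (Q : M → M → Prop), (∀ x y, Q x y → Sim Γ x y) →
      (∀ s t : (hierLang Γ).Term (ULift.{u} (Fin 1)),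
        Q (s.realize fun _ => a) (t.realize fun _ => a) ↔
        Q (s.realize fun _ => b) (t.realize fun _ => b)) →
      ∀ s t : (hierLang Γ).Term (A ⊕ ULift.{u} (Fin 1)),
        Q (s.realize (extend A a)) (t.realize (extend A a)) ↔
        Q (s.realize (extend A b)) (t.realize (extend A b)) := by
    intro Q hQ hQab s t
    rcases h.term_extend ha hb s with ⟨c, ⟨x, hx, hc⟩, h0a, h0b⟩ | ⟨s', h0a, h0b⟩ <;>
    rcases h.term_extend ha hb t with ⟨d, ⟨y, hy, hd⟩, h1a, h1b⟩ | ⟨t', h1a, h1b⟩ <;>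
    rw [h0a, h0b, h1a, h1b]
    · exact iff_of_false (fun h' => key t' ha hx hc (h.symm _ _ (hQ _ _ h')))
        (fun h' => key t' hb hx hc (h.symm _ _ (hQ _ _ h')))
    · exact iff_of_false (fun h' => key s' ha hy hd (hQ _ _ h'))
        (fun h' => key s' hb hy hd (hQ _ _ h'))
    · exact hQab s' t'
  refine ⟨binary (· = ·) (fun x y hxy => hxy ▸ h.refl x) hab.eq_iff, fun {n} R ts => ?_⟩
  rcases R with γ | _ | _ | _
  · rw [relMap_lab, relMap_lab]
    rcases h.term_extend ha hb (ts 0) with ⟨c, -, h0a, h0b⟩ | ⟨s, h0a, h0b⟩ <;>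
    rw [h0a, h0b]
    have := hab.rel_iff (labSymb γ) ![s]
    rwa [relMap_lab, relMap_lab] at this
  · rw [relMap_sim, relMap_sim]
    refine binary (Sim Γ) (fun _ _ => id) (fun s t => ?_) _ _
    have := hab.rel_iff (simSymb Γ) ![s, t]
    rwa [relMap_sim, relMap_sim] at this
  · rw [relMap_mem, relMap_mem]
    refine binary (Mem Γ) h.sim_of_mem (fun s t => ?_) _ _
    have := hab.rel_iff (memSymb Γ) ![s, t]
    rwa [relMap_mem, relMap_mem] at this
  · rw [relMap_lt, relMap_lt]
    refine binary (Lt Γ) h.sim_of_lt (fun s t => ?_) _ _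
    have := hab.rel_iff (ltSymb Γ) ![s, t]
    rwa [relMap_lt, relMap_lt] at this

/-- Elements in components meeting `A` are counted one by one; all others are counted by their types
over the empty set. -/
theorem hierAEC_stableIn (hΓ : ℵ₀ ≤ #Γ) {α : Ordinal.{u}} (hρ : ∀ s, ρ s < α) (hα : 1 ≤ α)
    {μ : Cardinal.{u}} (hμ : bethFrom #Γ α ≤ μ) : (hierAEC ρ).StableIn μ := by
  classical
  intro M _ hM A hA
  have h : IsHier ρ M := hM.2
  have hμ0 : ℵ₀ ≤ μ := (hΓ.trans (le_bethFrom _ _)).trans hμ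
  -- The rank condition always holds, by `hρ`; it puts the components meeting `A` in the form
  -- bounded by `IsHier.card_rank_lt_le`.
  let C : Set M := ⋃ x : A, {y | Sim Γ y x.1 ∧ ρ (lab Γ y) < α}
  have hC : #C ≤ μ := by
    refine (Cardinal.mk_iUnion_le _).trans ?_
    refine (mul_le_mul' hA (ciSup_le' fun x => ?_)).trans (Cardinal.mul_eq_self hμ0).le
    exact (h.card_rank_lt_le hΓ x.1 α).trans hμ
  -- There are at most `2^λ = ℶ_1(λ)` sets of formulas, which is where `1 ≤ α` enters.
  have hF : #(Set ((hierLang Γ).Formula (ULift.{u} (Fin 1)))) ≤ μ := by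
    have h1 : #((hierLang Γ).Formula (ULift.{u} (Fin 1))) ≤ #Γ := by
      refine card_formula_le.trans (max_le hΓ ?_)
      rw [card_hierLang hΓ]
      simp only [Cardinal.mk_fintype, Fintype.card_ulift, Fintype.card_fin, Nat.cast_one]
      rw [add_comm, Cardinal.add_one_eq hΓ]
    have h2 : bethFrom #Γ 1 = 2 ^ #Γ := by
      have := bethFrom_succ #Γ 0
      rwa [bethFrom_zero, Order.succ_eq_add_one, zero_add] at this
    rw [Cardinal.mk_set]
    exact ((Cardinal.power_le_power_left two_ne_zero h1).trans h2.ge).trans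
      (((bethFrom_strictMono _).monotone hα).trans hμ)
  let tp : M → Set ((hierLang Γ).Formula (ULift.{u} (Fin 1))) := fun a =>
    {φ | φ.Realize fun _ => a}
  let T : M → Σ k : ℕ, (hierAEC ρ).GType A k := fun a =>
    ⟨1, (hierAEC ρ).gtp hM A fun _ => a⟩
  let T₀ : Σ k : ℕ, (hierAEC ρ).GType A k := ⟨0, (hierAEC ρ).gtp hM A Fin.elim0⟩
  have hT : ∀ a b : M, a ∉ C → b ∉ C → tp a = tp b → T a = T b := by
    intro a b ha hb hab
    refine congrArg (Sigma.mk 1) (AEC.mk_eq_of_sameAtoms (hierAEC_JEP ρ) ?_)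
    exact h.sameAtoms_extend (fun x hx hs => ha (Set.mem_iUnion.2 ⟨⟨x, hx⟩, hs, hρ _⟩))
      (fun x hx hs => hb (Set.mem_iUnion.2 ⟨⟨x, hx⟩, hs, hρ _⟩))
      (sameAtoms_of_realize_iff fun φ => Set.ext_iff.1 hab φ)
  -- The first summand covers the type of the empty tuple. `T₀` is also the default for sets of
  -- formulas not realized outside `C`.
  let G : PUnit.{u + 1} ⊕ C ⊕ Set ((hierLang Γ).Formula (ULift.{u} (Fin 1))) →
      Σ k : ℕ, (hierAEC ρ).GType A k :=
    Sum.elim (fun _ => T₀) (Sum.elim (fun c => T c)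
      fun s => if hs : ∃ b, b ∉ C ∧ tp b = s then T hs.choose else T₀)
  have hG : (hierAEC ρ).gS 2 hM A ⊆ Set.range G := by
    rintro _ ⟨k, hk, a, rfl⟩
    obtain rfl | rfl : k = 0 ∨ k = 1 := by omega
    · refine ⟨.inl ⟨⟩, ?_⟩
      rw [Subsingleton.elim a Fin.elim0]
      rfl
    · have ha : a = fun _ => a 0 := funext fun i => congrArg a (Subsingleton.elim _ _)
      rw [ha]
      by_cases haC : a 0 ∈ C
      · exact ⟨.inr (.inl ⟨a 0, haC⟩), rfl⟩
      · have hs : ∃ b, b ∉ C ∧ tp b = tp (a 0) := ⟨a 0, haC, rfl⟩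
        refine ⟨.inr (.inr (tp (a 0))), (dif_pos hs).trans ?_⟩
        exact hT _ _ hs.choose_spec.1 haC hs.choose_spec.2
  refine (Cardinal.mk_le_mk_of_subset hG).trans ?_
  have hr := Cardinal.mk_range_le_lift (f := G)
  rw [Cardinal.lift_id'.{u, u + 1}] at hr
  refine hr.trans (Cardinal.lift_le.2 ?_)
  rw [Cardinal.mk_sum, Cardinal.mk_sum]
  simp only [Cardinal.lift_id, Cardinal.mk_fintype, Fintype.card_unique, Nat.cast_one]
  calc 1 + (#C + #(Set ((hierLang Γ).Formula (ULift.{u} (Fin 1))))) ≤ μ + (μ + μ) :=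
        add_le_add (Cardinal.one_le_aleph0.trans hμ0) (add_le_add hC hF)
    _ = μ := by rw [Cardinal.add_eq_self hμ0, Cardinal.add_eq_self hμ0]

end Hier

/-! ### The standard component of size `ℶ_α` -/

theorem exists_lt_bethFrom_succ {κ c : Cardinal.{u}} {β : Ordinal.{u}} (hβ : β ≠ 0)
    (hc : c < bethFrom κ β) : ∃ γ < β, c < bethFrom κ (Order.succ γ) := by
  rcases Ordinal.zero_or_succ_or_isSuccLimit β with rfl | ⟨γ, rfl⟩ | hlim
  · exact absurd rfl hβ
  · exact ⟨γ, Order.lt_succ γ, hc⟩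
  · have : Nonempty (Set.Iio β) := ⟨⟨0, hlim.bot_lt⟩⟩
    rw [bethFrom_limit κ hlim, lt_ciSup_iff Cardinal.bddAbove_of_small] at hc
    obtain ⟨⟨γ, hγ⟩, hc⟩ := hc
    exact ⟨γ, hγ, hc.trans (bethFrom_strictMono κ (Order.lt_succ γ))⟩

/-- A set of size `ℶ_α`, stratified in levels such that there are `ℶ_β` elements of level less
than `β`. -/
theorem exists_levels (κ : Cardinal.{u}) {α : Ordinal.{u}} (hα : α ≠ 0) :
    ∃ (X : Type u) (_ : LinearOrder X) (lev : X → Ordinal.{u}), #X = bethFrom κ α ∧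
      (∀ x, lev x < α) ∧ (∀ β ≤ α, #{x | lev x < β} ≤ bethFrom κ β) ∧
      ∀ β ≤ α, β ≠ 0 → bethFrom κ β ≤ #{x | lev x < β} := by
  let X := (bethFrom κ α).ord.ToType
  let o : X → Ordinal.{u} := fun x => x.toOrd.1
  have ho : ∀ x y, o x = o y → x = y := fun x y h =>
    Ordinal.ToType.mk.symm.injective (Subtype.ext h)
  -- With the successor here, level `0` consists of the positions of cardinality below `2^κ`. For `β
  -- ≠ 0`, level below `β` means cardinality below `ℶ_β`, at limits too.
  let lev : X → Ordinal.{u} := fun x => sInf {β | (o x).card < bethFrom κ (Order.succ β)}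
  have hlev : ∀ (β : Ordinal.{u}) (x : X), β ≠ 0 → (o x).card < bethFrom κ β → lev x < β := by
    intro β x hβ hx
    obtain ⟨γ, hγ, hc⟩ := exists_lt_bethFrom_succ hβ hx
    exact lt_of_le_of_lt (csInf_le' (show γ ∈ {β | (o x).card < bethFrom κ (Order.succ β)} from hc)) hγ
  have hX : ∀ x : X, (o x).card < bethFrom κ α := fun x => Cardinal.lt_ord.1 x.toOrd.2
  have hmem : ∀ x : X, (o x).card < bethFrom κ (Order.succ (lev x)) := fun x =>
    csInf_mem (s := {β | (o x).card < bethFrom κ (Order.succ β)})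
      ((exists_lt_bethFrom_succ hα (hX x)).imp fun _ h => h.2)
  refine ⟨X, inferInstance, lev, Cardinal.mk_ord_toType _, fun x => hlev α x hα (hX x),
    fun β hβ => ?_, fun β hβ hβ0 => ?_⟩
  · conv_rhs => rw [← Cardinal.mk_ord_toType (bethFrom κ β)]
    have h1 : ∀ x : {x | lev x < β}, o x.1 < (bethFrom κ β).ord := fun x =>
      Cardinal.lt_ord.2 ((hmem x.1).trans_le
        ((bethFrom_strictMono κ).monotone (Order.succ_le_of_lt x.2)))
    refine Cardinal.mk_le_of_injective
      (f := fun x : {x | lev x < β} => Ordinal.ToType.mk ⟨o x.1, h1 x⟩) fun x y hxy => ?_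
    have := congrArg Subtype.val (Ordinal.ToType.mk.injective hxy)
    exact Subtype.ext (ho _ _ this)
  · conv_lhs => rw [← Cardinal.mk_ord_toType (bethFrom κ β)]
    have h1 : ∀ y : (bethFrom κ β).ord.ToType, y.toOrd.1 < (bethFrom κ α).ord := fun y =>
      lt_of_lt_of_le y.toOrd.2 (Cardinal.ord_le_ord.2 ((bethFrom_strictMono κ).monotone hβ))
    have h2 : ∀ y, o (Ordinal.ToType.mk ⟨y.toOrd.1, h1 y⟩) = y.toOrd.1 := fun y => by
      simp [o]
    refine Cardinal.mk_le_of_injective (f := fun y : (bethFrom κ β).ord.ToType =>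
      (⟨Ordinal.ToType.mk ⟨y.toOrd.1, h1 y⟩, hlev _ _ hβ0 ?_⟩ : {x | lev x < β}))
      fun x y hxy => ?_
    · rw [h2]
      exact Cardinal.lt_ord.1 y.toOrd.2
    · have h3 := congrArg o (congrArg Subtype.val hxy)
      simp only [h2] at h3
      exact Ordinal.ToType.mk.symm.injective (Subtype.ext h3)

namespace Hier

open FirstOrder.Language Structure

variable {Γ : Type u} {ρ : Set Γ → Ordinal.{u}}

/-- Level `β` has at most `ℶ_{β+1} = 2^{ℶ_β}` elements, so its elements can be named by distinct
subsets of `Γ` together with the lower levels. -/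
theorem exists_level_codes {α : Ordinal.{u}} {X : Type u} {lev : X → Ordinal.{u}}
    (hlev : ∀ x, lev x < α) (hle : ∀ β ≤ α, #{x | lev x < β} ≤ bethFrom #Γ β)
    (hge : ∀ β ≤ α, β ≠ 0 → bethFrom #Γ β ≤ #{x | lev x < β}) :
    ∃ T : X → Set (Γ ⊕ X), (∀ x z, Sum.inr z ∈ T x → lev z < lev x) ∧
      ∀ x y, lev x = lev y → T x = T y → x = y := by
  have key : ∀ β : Ordinal.{u}, ∃ f : {x | lev x = β} → Set (Γ ⊕ {x | lev x < β}),
      Function.Injective f := by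
    intro β
    suffices h : #{x | lev x = β} ≤ #(Set (Γ ⊕ {x | lev x < β})) from
      h.elim fun e => ⟨e, e.injective⟩
    by_cases hβ : β < α
    · have h1 : #{x | lev x = β} ≤ bethFrom #Γ (Order.succ β) :=
        (Cardinal.mk_le_mk_of_subset fun x (hx : lev x = β) =>
          show lev x < Order.succ β from hx ▸ Order.lt_succ _).trans
          (hle _ (Order.succ_le_of_lt hβ))
      rw [Cardinal.mk_set]
      refine h1.trans ?_
      rw [bethFrom_succ]
      refine Cardinal.power_le_power_left two_ne_zero ?_
      rw [Cardinal.mk_sum, Cardinal.lift_id, Cardinal.lift_id]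
      -- At level `0` nothing lies below, and `Γ` alone supplies the `2^λ` codes.
      by_cases h0 : β = 0
      · rw [h0, bethFrom_zero]
        exact le_self_add
      · exact (hge β hβ.le h0).trans le_add_self
    · have : IsEmpty {x | lev x = β} := ⟨fun x => hβ (x.2 ▸ hlev x.1)⟩
      simp
  choose f hf using key
  let m : ∀ β : Ordinal.{u}, Γ ⊕ {x | lev x < β} → Γ ⊕ X := fun β => Sum.map id Subtype.val
  have hm : ∀ β, Function.Injective (m β) := fun β =>
    Function.Injective.sumMap Function.injective_id Subtype.val_injective
  have hinj : ∀ β (x y : {x | lev x = β}), m β '' f β x = m β '' f β y → x = y :=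
    fun β x y hxy => hf β ((hm β).image_injective hxy)
  refine ⟨fun x => m (lev x) '' f (lev x) ⟨x, rfl⟩, ?_, fun x y hxy hT => ?_⟩
  · rintro x z ⟨p, -, hp⟩
    rcases p with γ | z'
    · exact (Sum.inl_ne_inr hp).elim
    · obtain rfl : z'.1 = z := Sum.inr_injective hp
      exact z'.2
  · have hcast : ∀ β β' (hx : lev y = β) (hx' : lev y = β'),
        m β '' f β ⟨y, hx⟩ = m β' '' f β' ⟨y, hx'⟩ := by
      rintro _ _ rfl rfl
      rfl
    exact congrArg Subtype.val (hinj (lev x) ⟨x, rfl⟩ ⟨y, hxy.symm⟩ (hT.trans (hcast _ _ _ _)))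

end Hier

namespace Hier

open FirstOrder.Language Structure

variable {Γ : Type u} {ρ : Set Γ → Ordinal.{u}}

/-- A labelled hierarchy with one component that has `ℶ_β` elements of rank less than `β` for
all `0 < β ≤ α`, linearly ordered by the auxiliary relation. -/
theorem exists_standard {α : Ordinal.{u}} (hα : α ≠ 0)
    {lb : Ordinal.{u} → Set Γ → Set Γ} (hlb : ∀ β < α, ∀ s, ρ (lb β s) = β)
    (hlb' : ∀ β < α, Function.Injective (lb β)) :
    ∃ (X : Type u) (_ : LinearOrder X) (_ : (hierLang Γ).Structure X), #X = bethFrom #Γ α ∧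
      IsHier ρ X ∧ (∀ x y : X, Sim Γ x y) ∧ (∀ x y : X, Lt Γ x y ↔ x < y) ∧
      ∀ β ≤ α, β ≠ 0 → bethFrom #Γ β ≤ #{x : X | ρ (lab Γ x) < β} := by
  classical
  obtain ⟨X, hX, lev, hcard, hlev, hle, hge⟩ := exists_levels #Γ hα
  obtain ⟨T, hT, hTinj⟩ := exists_level_codes hlev hle hge
  let mem : X → X → Prop := fun z x => Sum.inr z ∈ T x
  -- The code is split in two: its part in `Γ` goes into a label of rank `lev x`, its part in `X`
  -- becomes the set of members.
  let lb' : X → Set Γ := fun x => lb (lev x) {γ | Sum.inl γ ∈ T x}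
  let w : X → X → X := fun x y =>
    if h : ∃ z, lev z < lev x ∧ ¬ (mem z x ↔ mem z y) then h.choose else x
  have hρ : ∀ x, ρ (lb' x) = lev x := fun x => hlb _ (hlev x) _
  have hw : ∀ x y, x ≠ y → lb' x = lb' y →
      lev (w x y) < lev x ∧ ¬ (mem (w x y) x ↔ mem (w x y) y) := by
    intro x y hne hl
    have hxy : lev x = lev y := by rw [← hρ, hl, hρ]
    have hs : {γ | Sum.inl γ ∈ T x} = {γ | Sum.inl γ ∈ T y} := by
      refine hlb' (lev x) (hlev x) (hl.trans ?_)
      simp only [lb', hxy]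
    have hex : ∃ z, lev z < lev x ∧ ¬ (mem z x ↔ mem z y) := by
      by_contra! hcon
      refine hne (hTinj x y hxy (Set.ext ?_))
      rintro (γ | z)
      · exact Set.ext_iff.1 hs γ
      · by_cases hz : lev z < lev x
        · exact hcon z hz
        · exact iff_of_false (fun h => hz (hT _ _ h)) (fun h => hz (hxy ▸ hT _ _ h))
    simp only [w, dif_pos hex]
    exact hex.choose_spec
  let _ : (hierLang Γ).Structure X := mkStructure (fun _ _ => True) mem (· < ·) w lb'
  have hlab : ∀ x : X, lab Γ x = lb' x := fun x => rfl
  refine ⟨X, hX, inferInstance, hcard, ?_, fun _ _ => trivial, fun _ _ => Iff.rfl, ?_⟩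
  · exact
      { refl := fun _ => trivial
        symm := fun _ _ _ => trivial
        trans := fun _ _ _ _ _ => trivial
        sim_of_mem := fun _ _ _ => trivial
        sim_of_lt := fun _ _ _ => trivial
        wit_sim := fun _ _ => trivial
        wit_of_not_sim := fun _ _ h => (h trivial).elim
        rank_wit_lt := fun x y _ hne hl => by
          rw [hlab, hlab, hρ, hρ]
          exact (hw x y hne hl).1
        mem_wit := fun x y _ hne hl => (hw x y hne hl).2 }
  · intro β hβ h0
    simp only [hlab, hρ]
    exact hge β hβ h0

/-! ### Order property, instability and failure of amalgamation -/

section SameAtoms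

variable {M N : Type u} [(hierLang Γ).Structure M] [(hierLang Γ).Structure N] {β : Type u}
  {v : β → M} {w : β → N}

theorem lt_iff_of_sameAtoms (h : (hierLang Γ).SameAtoms v w) (i j : β) :
    Lt Γ (v i) (v j) ↔ Lt Γ (w i) (w j) := by
  have := h.rel_iff (ltSymb Γ) ![Term.var i, Term.var j]
  rwa [relMap_lt, relMap_lt] at this

theorem mem_iff_of_sameAtoms (h : (hierLang Γ).SameAtoms v w) (i j : β) :
    Mem Γ (v i) (v j) ↔ Mem Γ (w i) (w j) := by
  have := h.rel_iff (memSymb Γ) ![Term.var i, Term.var j]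
  rwa [relMap_mem, relMap_mem] at this

theorem lab_eq_of_sameAtoms (h : (hierLang Γ).SameAtoms v w) (i : β) :
    lab Γ (v i) = lab Γ (w i) := by
  ext γ
  have := h.rel_iff (labSymb γ) ![Term.var i]
  rwa [relMap_lab, relMap_lab] at this

end SameAtoms

variable {X : Type u} [(hierLang Γ).Structure X]

theorem orderPropertyStar_of_linearOrder [LinearOrder X] [Nonempty X] (h : IsHier ρ X)
    (hlt : ∀ x y : X, Lt Γ x y ↔ x < y) {μ : Cardinal.{u}} (hμ : μ ≤ #X) :
    (hierAEC ρ).OrderPropertyStar μ := by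
  obtain ⟨I, hI⟩ := Cardinal.le_mk_iff_exists_set.1 hμ
  have hM : (hierAEC ρ).Mem X := ⟨inferInstance, h⟩
  refine ⟨1, I, inferInstance, X, inferInstance, hM, fun i _ => i.1, hI, ?_⟩
  intro i₀ i₁ j₀ j₁ hi hj heq
  have := lt_iff_of_sameAtoms (AEC.sameAtoms_of_mk_eq heq) (Sum.inr ⟨0⟩) (Sum.inr ⟨1⟩)
  have h1 : Lt Γ i₀.1 i₁.1 ↔ Lt Γ j₁.1 j₀.1 := this
  rw [hlt, hlt] at h1
  exact lt_asymm hj (h1.1 hi)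

/-- Take the least `β` with `μ < ℶ_{β+1}`. The more than `μ` elements of rank at most `β` are told
apart by their labels and their members of rank below `β`, and at most `μ` elements have rank below
`β`. -/
theorem not_stableIn_of_card [Nonempty X] (h : IsHier ρ X) (hΓ : ℵ₀ ≤ #Γ)
    (hsim : ∀ x y : X, Sim Γ x y) {α : Ordinal.{u}} (hα : α ≠ 0)
    (hge : ∀ β ≤ α, β ≠ 0 → bethFrom #Γ β ≤ #{x : X | ρ (lab Γ x) < β})
    {μ : Cardinal.{u}} (hμ : μ < bethFrom #Γ α) : ¬ (hierAEC ρ).StableIn μ := by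
  intro hstable
  have hM : (hierAEC ρ).Mem X := ⟨inferInstance, h⟩
  have hne : {β | β < α ∧ μ < bethFrom #Γ (Order.succ β)}.Nonempty :=
    exists_lt_bethFrom_succ hα hμ
  obtain ⟨hβα, hβ⟩ := csInf_mem hne
  set β := sInf {β | β < α ∧ μ < bethFrom #Γ (Order.succ β)} with hβdef
  have hmin : β ≠ 0 → bethFrom #Γ β ≤ μ := by
    intro h0
    by_contra! hlt
    obtain ⟨γ, hγ, hc⟩ := exists_lt_bethFrom_succ h0 hlt
    exact absurd (csInf_le' (show γ ∈ {β | β < α ∧ μ < bethFrom #Γ (Order.succ β)} from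
      ⟨hγ.trans hβα, hc⟩)) (not_le_of_gt hγ)
  let A : Set X := {x | ρ (lab Γ x) < β}
  obtain ⟨x₀⟩ : Nonempty X := inferInstance
  have hA : #A ≤ μ := by
    -- For `β = 0` the cardinal `μ` may be below `λ`, even finite, but then no element has rank
    -- below `β`.
    by_cases h0 : β = 0
    · have : IsEmpty A := ⟨fun x => not_lt_zero (h0 ▸ x.2 : ρ (lab Γ x.1) < 0)⟩
      simp
    · refine le_trans ?_ (hmin h0)
      refine (Cardinal.mk_le_mk_of_subset ?_).trans (h.card_rank_lt_le hΓ x₀ β)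
      exact fun x hx => ⟨hsim x x₀, hx⟩
  let B : Set X := {x | ρ (lab Γ x) < Order.succ β}
  have hB : μ < #B := hβ.trans_le
    (hge _ (Order.succ_le_of_lt hβα) (Order.succ_ne_bot β))
  let T : B → (hierAEC ρ).gS 2 hM A := fun b =>
    ⟨⟨1, (hierAEC ρ).gtp hM A fun _ => b.1⟩, 1, one_lt_two, fun _ => b.1, rfl⟩
  have hT : Function.Injective T := by
    rintro ⟨b, hb⟩ ⟨c, hc⟩ hbc
    have hgtp : (hierAEC ρ).gtp hM A (fun _ : Fin 1 => b) = (hierAEC ρ).gtp hM A fun _ => c :=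
      sigma_mk_injective (congrArg Subtype.val hbc)
    have hs := AEC.sameAtoms_of_mk_eq hgtp
    have hl : lab Γ b = lab Γ c := lab_eq_of_sameAtoms hs (Sum.inr ⟨0⟩)
    by_contra hne
    have hne' : b ≠ c := fun h' => hne (Subtype.ext h')
    have hw : wit Γ b c ∈ A :=
      (h.rank_wit_lt b c (hsim b c) hne' hl).trans_le (Order.lt_succ_iff.1 hb)
    exact h.mem_wit b c (hsim b c) hne' hl
      (mem_iff_of_sameAtoms hs (Sum.inl ⟨_, hw⟩) (Sum.inr ⟨0⟩))
  -- Galois types live one universe up, so `B` is lifted before comparing cardinals.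
  have h1 := Cardinal.mk_le_of_injective
    (f := fun b : ULift.{u + 1} B => T b.down) (hT.comp ULift.down_injective)
  rw [Cardinal.mk_uLift] at h1
  have h2 := h1.trans (hstable hM A hA)
  rw [Cardinal.lift_le] at h2
  exact absurd hB (not_lt_of_ge h2)

/-- The structure with an element `true` of label `l₁` and an element `false` of label `l₀`, which
is a member of `true` if `p` holds. -/
@[reducible]
def twoStructure (l₀ l₁ : Set Γ) (p : Prop) : (hierLang Γ).Structure (ULift.{u} Bool) :=
  mkStructure (fun _ _ => True) (fun x y => p ∧ x.down = false ∧ y.down = true)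
    (fun _ _ => False) (fun x _ => x) fun x => bif x.down then l₁ else l₀

/-- The structure with a single element of label `l`. -/
@[reducible]
def oneStructure (l : Set Γ) : (hierLang Γ).Structure PUnit.{u + 1} :=
  mkStructure (fun _ _ => True) (fun _ _ => False) (fun _ _ => False) (fun x _ => x) fun _ => l

theorem isHier_twoStructure {l₀ l₁ : Set Γ} (hl : l₀ ≠ l₁) (p : Prop) :
    letI := twoStructure l₀ l₁ p
    IsHier ρ (ULift.{u} Bool) := by
  let _ := twoStructure l₀ l₁ p
  have key : ∀ x y : ULift.{u} Bool, lab Γ x = lab Γ y → x = y := by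
    rintro ⟨_ | _⟩ ⟨_ | _⟩ h
    · rfl
    · exact (hl h).elim
    · exact (hl h.symm).elim
    · rfl
  exact
    { refl := fun _ => trivial
      symm := fun _ _ _ => trivial
      trans := fun _ _ _ _ _ => trivial
      sim_of_mem := fun _ _ _ => trivial
      sim_of_lt := fun _ _ _ => trivial
      wit_sim := fun _ _ => trivial
      wit_of_not_sim := fun _ _ h => (h trivial).elim
      rank_wit_lt := fun x y _ hne h => (hne (key x y h)).elim
      mem_wit := fun x y _ hne h => (hne (key x y h)).elim }

/-- The inclusion of the one-element structure into the two-element structure. -/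
def oneToTwo (l₀ l₁ : Set Γ) (p : Prop) :
    letI := twoStructure l₀ l₁ p
    letI := oneStructure l₁
    PUnit.{u + 1} ↪[hierLang Γ] ULift.{u} Bool :=
  letI := twoStructure l₀ l₁ p
  letI := oneStructure l₁
  mkEmbedding (fun _ => ⟨true⟩) (fun _ _ _ => rfl) (fun _ _ => Iff.rfl)
    (fun _ _ => iff_of_false (fun h => Bool.noConfusion h.2.1) id) (fun _ _ => Iff.rfl)
    (fun _ _ => rfl) fun _ => rfl

/-- Over a point of label `l₁`, one extension adds an element of label `l₀` that is a member of the
point, the other such an element that is not. As `l₀` has rank `0`, an amalgam would have to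
identify the two. -/
theorem hierAEC_not_AP {l₀ l₁ : Set Γ} (h₀ : ρ l₀ = 0) (hl : l₀ ≠ l₁) : ¬ (hierAEC ρ).AP := by
  intro hAP
  obtain ⟨N, iN, g₁, g₂, hg₁, -, hg⟩ :=
    @hAP _ _ _ (oneStructure l₁) (twoStructure l₀ l₁ True) (twoStructure l₀ l₁ False)
      (oneToTwo l₀ l₁ True) (oneToTwo l₀ l₁ False)
      (@AEC.ofUniversal_isEmb _ _ (isUniversal ρ) _ _ (_) (_) _ ⟨⟨⟩⟩ (isHier_twoStructure hl True))
      (@AEC.ofUniversal_isEmb _ _ (isUniversal ρ) _ _ (_) (_) _ ⟨⟨⟩⟩ (isHier_twoStructure hl False))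
  have hN : IsHier ρ N := hg₁.2.1.2
  have hx : g₁ ⟨true⟩ = g₂ ⟨true⟩ := hg ⟨⟩
  have hl₁ : lab Γ (g₁ ⟨false⟩) = l₀ :=
    @lab_map Γ _ (twoStructure l₀ l₁ True) _ _ g₁ ⟨false⟩
  have hl₂ : lab Γ (g₂ ⟨false⟩) = l₀ :=
    @lab_map Γ _ (twoStructure l₀ l₁ False) _ _ g₂ ⟨false⟩
  have hs₁ : Sim Γ (g₁ ⟨false⟩) (g₁ ⟨true⟩) :=
    (@sim_map Γ _ (twoStructure l₀ l₁ True) _ _ g₁ _ _).2 trivial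
  have hs₂ : Sim Γ (g₂ ⟨true⟩) (g₂ ⟨false⟩) :=
    (@sim_map Γ _ (twoStructure l₀ l₁ False) _ _ g₂ _ _).2 trivial
  have hm₁ : Mem Γ (g₁ ⟨false⟩) (g₁ ⟨true⟩) :=
    (@mem_map Γ _ (twoStructure l₀ l₁ True) _ _ g₁ _ _).2 ⟨trivial, rfl, rfl⟩
  have hm₂ : ¬ Mem Γ (g₂ ⟨false⟩) (g₂ ⟨true⟩) := fun h =>
    ((@mem_map Γ _ (twoStructure l₀ l₁ False) _ _ g₂ _ _).1 h).1
  -- Otherwise their witness would have rank below `0`.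
  have hu : g₁ ⟨false⟩ = g₂ ⟨false⟩ := by
    by_contra hne
    have := hN.rank_wit_lt _ _ (hN.trans _ _ _ hs₁ (hx ▸ hs₂)) hne (hl₁.trans hl₂.symm)
    rw [hl₁, h₀] at this
    exact not_lt_zero this
  exact hm₂ (hu ▸ hx ▸ hm₁)

/-- Since `2^λ · |α| = 2^λ`, a bijection of `Set Γ × α` with `Set Γ` splits the labels into `α` many
ranks, each containing a copy of `Set Γ`. -/
theorem exists_rank {α : Ordinal.{u}} (hΓ : ℵ₀ ≤ #Γ) (hα : α ≠ 0) (hα' : α.card ≤ 2 ^ #Γ) :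
    ∃ (ρ : Set Γ → Ordinal.{u}) (lb : Ordinal.{u} → Set Γ → Set Γ), (∀ s, ρ s < α) ∧
      (∀ β < α, ∀ s, ρ (lb β s) = β) ∧ ∀ β < α, Function.Injective (lb β) := by
  classical
  have hcard : #(Set Γ × α.ToType) = #(Set Γ) := by
    rw [Cardinal.mk_prod, Cardinal.lift_id, Cardinal.lift_id, Cardinal.mk_set,
      Cardinal.mk_toType]
    exact Cardinal.mul_eq_left (hΓ.trans (Cardinal.cantor _).le) hα' (by simpa using hα)
  obtain ⟨e⟩ := Cardinal.eq.1 hcard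
  refine ⟨fun s => (e.symm s).2.toOrd.1, fun β s =>
    if h : β < α then e (s, Ordinal.ToType.mk ⟨β, h⟩) else ∅, fun s => (e.symm s).2.toOrd.2,
    fun β hβ s => ?_, fun β hβ s t hst => ?_⟩
  · simp [hβ]
  · simpa [hβ] using hst

end Hier

/-! ### Assembly of the theorem -/

open Hier in
theorem mainTheorem1 (lam : Cardinal.{u}) (hlam : ℵ₀ ≤ lam) (α : Ordinal.{u})
    (hα : lam.ord ≤ α) (hα' : α < (Order.succ ((2 : Cardinal.{u}) ^ lam)).ord) :
    ∃ (L : FirstOrder.Language.{u, u}) (K : AEC L),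
      K.LS = lam ∧
      K.Stable ∧
      (∀ μ : Cardinal.{u}, bethFrom lam α ≤ μ → K.StableIn μ) ∧
      (∀ μ : Cardinal.{u}, μ ≤ bethFrom lam α → K.OrderPropertyStar μ) ∧
      (∀ μ : Cardinal.{u}, μ < bethFrom lam α → ¬ K.StableIn μ) ∧
      K.JEP ∧ K.NMM ∧ K.Tame ℵ₀ ∧ ¬ K.AP := by
  obtain ⟨Γ, rfl⟩ : ∃ Γ : Type u, #Γ = lam := ⟨lam.out, Cardinal.mk_out lam⟩
  have hα1 : 1 < α := by
    refine lt_of_lt_of_le ?_ hα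
    exact Ordinal.one_lt_omega0.trans_le (Cardinal.ord_aleph0 ▸ Cardinal.ord_le_ord.2 hlam)
  have hα0 : α ≠ 0 := (zero_lt_one.trans hα1).ne'
  have hcard : α.card ≤ 2 ^ #Γ := Order.lt_succ_iff.1 (Cardinal.lt_ord.1 hα')
  obtain ⟨ρ, lb, hρ, hlb, hlb'⟩ := exists_rank hlam hα0 hcard
  obtain ⟨X, _, _, hX, hH, hsim, hlt, hge⟩ := exists_standard hα0 hlb hlb'
  have : Nonempty X := by
    rw [← Cardinal.mk_ne_zero_iff, hX]
    exact (Cardinal.aleph0_pos.trans_le (hlam.trans (le_bethFrom _ _))).ne'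
  have hstable : ∀ μ : Cardinal.{u}, bethFrom #Γ α ≤ μ → (hierAEC ρ).StableIn μ :=
    fun μ hμ => hierAEC_stableIn hlam hρ hα1.le hμ
  have hLS := hierAEC_LS ρ hlam
  refine ⟨hierLang Γ, hierAEC ρ, hLS, ⟨bethFrom #Γ α, hLS ▸ le_bethFrom _ _, hstable _ le_rfl⟩,
    hstable, fun μ hμ => orderPropertyStar_of_linearOrder hH hlt (hX ▸ hμ),
    fun μ hμ => not_stableIn_of_card hH hlam hsim hα0 hge hμ, hierAEC_JEP ρ, hierAEC_NMM ρ,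
    hierAEC_tame ρ, hierAEC_not_AP (l₀ := lb 0 ∅) (l₁ := lb 1 ∅) (hlb 0 (zero_lt_one.trans hα1) ∅)
      fun h => ?_⟩
  -- The labels `lb 0 ∅` and `lb 1 ∅` differ because their ranks `0` and `1` do; this uses `1 < α`.
  have h1 := congrArg ρ h
  rw [hlb 0 (zero_lt_one.trans hα1), hlb 1 hα1] at h1
  exact zero_ne_one h1
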